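/- **Theorem (COFL-Line optimization).** An instance of the problem COFL-Line consists of $n\ge 1$ points $p_1,\dots,p_n\in\mathbb{R}^2$, a segment $\overline{pq}$ in the plane, an integer $k\ge 1$ and a real number $\alpha>0$. Its optimal radius $\lambda^*$ is the maximum of $$\lambda=\min\Bigl\{\min_{1\le i\le n}\min_{1\le j\le k} d(p_i,c_j),\ \alpha\cdot\min_{1\le i\le k-1} d(c_i,c_{i+1})\Bigr\}$$ over all choices of $k$ centers $c_1,\dots,c_k$ on $\overline{pq}$, listed in the order in which they lie on the segment from $p$ to $q$ (for $k=1$ the second minimum is absent). There are a deterministic real RAM program and a constant $K$ such that, for every instance, the program halts with the exact value of $\lambda^*$ as its output after at most $$K\cdot\bigl(n^2\log (k+1)+n\log (k+1)\,\log(n^2+k)\bigr)$$ steps; for $k\ge 2$ this is $O\bigl(n^2\log k+n\log k\,\log(n^2+k)\bigr)$. Here a real RAM stores natural numbers (also used as addresses) and exact real numbers. The following take unit time: addition, truncated subtraction, halving and comparison of natural numbers; conversion of a natural number into a real number; arithmetic operations, comparisons and square roots of real numbers; the $j$-th smallest real root, for a constant $j$, of a polynomial of degree at most $4$ with given real coefficients;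 reading and writing of variables and memory cells; and branching and procedure calls. There is no floor function. -/

import Mathlib

/-! ## Real RAM

A random access machine with unit-cost steps, presented as a small imperative language.  It holds
natural numbers (sizes, counters, addresses) and exact real numbers.  There is no way to turn a real
number into a natural number: in particular there is no floor function. -/

namespace RealRAM

/-- A state: the scalar variables of the current procedure (finitely many are ever mentioned by a
program) and the memory, one array of cells for natural and one for real numbers. -/
structure State where
  nvar : ℕ → ℕ
  rvar : ℕ → ℝ
  nmem : ℕ → ℕ
  rmem : ℕ → ℝ

/-- Expressions for natural numbers; `sub` is truncated subtraction, `half` rounds down,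
`load e` reads the memory cell with address `e`. -/
inductive NExpr where
  | const (c : ℕ)
  | var (x : ℕ)
  | add (a b : NExpr)
  | sub (a b : NExpr)
  | half (a : NExpr)
  | load (a : NExpr)

namespace NExpr

def eval (s : State) : NExpr → ℕ
  | const c => c
  | var x => s.nvar x
  | add a b => a.eval s + b.eval s
  | sub a b => a.eval s - b.eval s
  | half a => a.eval s / 2
  | load a => s.nmem (a.eval s)

/-- The number of operations in an expression. -/
def cost : NExpr → ℕ
  | const _ => 1
  | var _ => 1
  | add a b => a.cost + b.cost + 1
  | sub a b => a.cost + b.cost + 1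
  | half a => a.cost + 1
  | load a => a.cost + 1

end NExpr

/-- The `j`-th smallest (counting from `0`) of the distinct real roots of
`a₀ + a₁ X + a₂ X² + a₃ X³ + a₄ X⁴`; it is `0` if there is no such root, and for the zero
polynomial. -/
noncomputable def quarticRoot (j : ℕ) (a₀ a₁ a₂ a₃ a₄ : ℝ) : ℝ :=
  ((Polynomial.C a₀ + Polynomial.C a₁ * Polynomial.X + Polynomial.C a₂ * Polynomial.X ^ 2 +
      Polynomial.C a₃ * Polynomial.X ^ 3 + Polynomial.C a₄ * Polynomial.X ^ 4).roots.toFinset.sort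
    (· ≤ ·)).getD j 0

/-- Expressions for real numbers.  The primitive operations are the conversion of a natural number,
the four arithmetic operations, square roots, and real roots of polynomials of degree at most four
(`root j a₀ a₁ a₂ a₃ a₄` is the `j`-th smallest root, for a fixed `j` written in the program). -/
inductive RExpr where
  | ofNat (a : NExpr)
  | var (x : ℕ)
  | add (a b : RExpr)
  | sub (a b : RExpr)
  | mul (a b : RExpr)
  | div (a b : RExpr)
  | sqrt (a : RExpr)
  | root (j : ℕ) (a₀ a₁ a₂ a₃ a₄ : RExpr)
  | load (a : NExpr)

namespace RExpr

noncomputable def eval (s : State) : RExpr → ℝ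
  | ofNat a => (a.eval s : ℝ)
  | var x => s.rvar x
  | add a b => a.eval s + b.eval s
  | sub a b => a.eval s - b.eval s
  | mul a b => a.eval s * b.eval s
  | div a b => a.eval s / b.eval s
  | sqrt a => Real.sqrt (a.eval s)
  | root j a₀ a₁ a₂ a₃ a₄ =>
      quarticRoot j (a₀.eval s) (a₁.eval s) (a₂.eval s) (a₃.eval s) (a₄.eval s)
  | load a => s.rmem (a.eval s)

def cost : RExpr → ℕ
  | ofNat a => a.cost + 1
  | var _ => 1
  | add a b => a.cost + b.cost + 1
  | sub a b => a.cost + b.cost + 1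
  | mul a b => a.cost + b.cost + 1
  | div a b => a.cost + b.cost + 1
  | sqrt a => a.cost + 1
  | root _ a₀ a₁ a₂ a₃ a₄ => a₀.cost + a₁.cost + a₂.cost + a₃.cost + a₄.cost + 1
  | load a => a.cost + 1

end RExpr

/-- Tests. -/
inductive Test where
  | ltN (a b : NExpr)
  | ltR (a b : RExpr)
  | not (b : Test)
  | and (b c : Test)

namespace Test

def holds (s : State) : Test → Prop
  | ltN a b => a.eval s < b.eval s
  | ltR a b => a.eval s < b.eval s
  | not b => ¬ b.holds s
  | and b c => b.holds s ∧ c.holds s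

def cost : Test → ℕ
  | ltN a b => a.cost + b.cost + 1
  | ltR a b => a.cost + b.cost + 1
  | not b => b.cost + 1
  | and b c => b.cost + c.cost + 1

end Test

/-- Commands.  `call x u f as bs` runs procedure number `f` with fresh variables, the first ones
being set to the values of the arguments `as` (natural numbers) and `bs` (real numbers) and the other
ones to `0`; on return the natural variable `0` and the real variable `0` of the procedure are copied
to the caller's variables `x` and `u`.  The memory is shared. -/
inductive Cmd where
  | skip
  | setN (x : ℕ) (a : NExpr)
  | setR (u : ℕ) (a : RExpr)
  | storeN (addr a : NExpr)
  | storeR (addr : NExpr) (a : RExpr)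
  | seq (c d : Cmd)
  | cond (b : Test) (c d : Cmd)
  | loop (b : Test) (c : Cmd)
  | call (x u f : ℕ) (as : List NExpr) (bs : List RExpr)

/-- The state in which the body of a procedure starts. -/
noncomputable def enter (s : State) (as : List NExpr) (bs : List RExpr) : State where
  nvar := fun i => (as.map (NExpr.eval s)).getD i 0
  rvar := fun i => (bs.map (RExpr.eval s)).getD i 0
  nmem := s.nmem
  rmem := s.rmem

/-- The state of the caller `s` after a procedure has ended in state `t`. -/
def leave (s t : State) (x u : ℕ) : State where
  nvar := Function.update s.nvar x (t.nvar 0)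
  rvar := Function.update s.rvar u (t.rvar 0)
  nmem := t.nmem
  rmem := t.rmem

/-- `Exec procs c s m t`: with the procedures `procs`, the command `c` started in state `s` halts in
state `t` after exactly `m` steps. -/
inductive Exec (procs : List Cmd) : Cmd → State → ℕ → State → Prop where
  | skip (s : State) : Exec procs .skip s 1 s
  | setN (s : State) (x : ℕ) (a : NExpr) :
      Exec procs (.setN x a) s (a.cost + 1) { s with nvar := Function.update s.nvar x (a.eval s) }
  | setR (s : State) (u : ℕ) (a : RExpr) :
      Exec procs (.setR u a) s (a.cost + 1) { s with rvar := Function.update s.rvar u (a.eval s) }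
  | storeN (s : State) (addr a : NExpr) :
      Exec procs (.storeN addr a) s (addr.cost + a.cost + 1)
        { s with nmem := Function.update s.nmem (addr.eval s) (a.eval s) }
  | storeR (s : State) (addr : NExpr) (a : RExpr) :
      Exec procs (.storeR addr a) s (addr.cost + a.cost + 1)
        { s with rmem := Function.update s.rmem (addr.eval s) (a.eval s) }
  | seq {c d : Cmd} {s t r : State} {m l : ℕ} :
      Exec procs c s m t → Exec procs d t l r → Exec procs (.seq c d) s (m + l) r
  | condTrue {b : Test} {c d : Cmd} {s t : State} {m : ℕ} :
      b.holds s → Exec procs c s m t → Exec procs (.cond b c d) s (b.cost + m + 1) t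
  | condFalse {b : Test} {c d : Cmd} {s t : State} {m : ℕ} :
      ¬ b.holds s → Exec procs d s m t → Exec procs (.cond b c d) s (b.cost + m + 1) t
  | loopTrue {b : Test} {c : Cmd} {s t r : State} {m l : ℕ} :
      b.holds s → Exec procs c s m t → Exec procs (.loop b c) t l r →
        Exec procs (.loop b c) s (b.cost + m + l + 1) r
  | loopFalse {b : Test} {c : Cmd} {s : State} :
      ¬ b.holds s → Exec procs (.loop b c) s (b.cost + 1) s
  | call {x u f : ℕ} {as : List NExpr} {bs : List RExpr} {body : Cmd} {s t : State} {m : ℕ} :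
      procs[f]? = some body → Exec procs body (enter s as bs) m t →
        Exec procs (.call x u f as bs) s
          ((as.map NExpr.cost).sum + (bs.map RExpr.cost).sum + m + 1) (leave s t x u)

/-- A program: finitely many procedures, which may call each other, and a main command. -/
structure Program where
  procs : List Cmd
  main : Cmd

/-- The program started in state `s` halts after exactly `m` steps in state `t`. -/
def Program.HaltsIn (A : Program) (s : State) (m : ℕ) (t : State) : Prop :=
  Exec A.procs A.main s m t

end RealRAM

/-! ## The constrained obnoxious facility location problem on a line segment -/

/-- `c` lists `k` centers on the segment from `p` to `q`, in the order in which they lie on it. -/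
def IsPlacement {k : ℕ} (p q : EuclideanSpace ℝ (Fin 2))
    (c : Fin k → EuclideanSpace ℝ (Fin 2)) : Prop :=
  ∃ s : Fin k → ℝ, Monotone s ∧ ∀ j, s j ∈ Set.Icc (0 : ℝ) 1 ∧ c j = AffineMap.lineMap p q (s j)

/-- The quantities whose minimum is to be maximized: the distances `d(p_i, c_j)`, and `α` times the
distances `d(c_i, c_{i+1})` (there are none of the latter if `k = 1`). -/
def coflTerms {n k : ℕ} (P : Fin n → EuclideanSpace ℝ (Fin 2)) (α : ℝ)
    (c : Fin k → EuclideanSpace ℝ (Fin 2)) : Set ℝ :=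
  {d | ∃ i j, d = dist (P i) (c j)} ∪
    {d | ∃ i j : Fin k, (i : ℕ) + 1 = j ∧ d = α * dist (c i) (c j)}

/-- `r` is the optimal radius: the largest value of `min (coflTerms P α c)` over all placements. -/
def IsOptimalRadius {n : ℕ} (k : ℕ) (P : Fin n → EuclideanSpace ℝ (Fin 2))
    (p q : EuclideanSpace ℝ (Fin 2)) (α : ℝ) (r : ℝ) : Prop :=
  IsGreatest
    {l : ℝ | ∃ c : Fin k → EuclideanSpace ℝ (Fin 2), IsPlacement p q c ∧ IsLeast (coflTerms P α c) l}
    r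

/-- The input of an instance: the natural variables `0, 1` hold `n, k`, the real variables
`0, …, 4` hold the coordinates of `p` and `q` and the number `α`, and the real memory cells
`2 i, 2 i + 1` hold the coordinates of the `i`-th demand point, `i = 0, …, n - 1`.  Everything
else is `0`. -/
noncomputable def coflInput {n : ℕ} (k : ℕ) (P : Fin n → EuclideanSpace ℝ (Fin 2))
    (p q : EuclideanSpace ℝ (Fin 2)) (α : ℝ) : RealRAM.State where
  nvar := fun x => [n, k].getD x 0
  rvar := fun x => [p 0, p 1, q 0, q 1, α].getD x 0
  nmem := fun _ => 0
  rmem := fun a => if h : a / 2 < n then P ⟨a / 2, h⟩ (if a % 2 = 0 then 0 else 1) else 0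

namespace RealRAM

/-! ### Notation for programs -/

/-! Measure positions along the line through `p` and `q`, and describe each demand point by its
coordinate `a` along the line and its squared distance `w` from it. A center at `x` is at distance
at least `v` from the point iff `x` avoids the open interval of half-length `√(v² - w)` around `a`
(`free_iff`). So a radius `v` is attainable iff `k` positions in `[0, L]`, with gaps at least `v /
α`, avoid these intervals: this is `Feas`, which is antitone in `v ≥ 0`. The optimum is the largest
feasible `v`.

Decision. With the points sorted by coordinate, a greedy placement from right to left decides
`Feas`. A recursion over the points carries the furthest right end of the intervals seen so far and
returns a bound for the next center. In each gap the number of centers that fit is found by binary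
search, as there is no floor function. This takes `O(n log k)` steps (`call_dec`).

Critical radii. If radii are increased until a placement gets stuck, then between the intervals of
two points, or an end of the segment, a chain of centers with `m` gaps `v / α` has become tight. The
critical radius of such a triple is the largest `v` with `√(v² - w₁) + √(v² - w₂) + m v / α ≤ d`. It
is one of constantly many explicit numbers, among them roots of polynomials of degree at most four
(`wp_tryTentative`). If no critical radius lies strictly between `lo` and an infeasible `hi`, then
no radius strictly between them is feasible (`not_feas_of_thresholds`).

Search. The candidates form `(n + 2)²` rows, one per ordered pair, in which they decrease with `m <
k`. Each round takes the middle candidates of the rows, selects their median weighted by row lengths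
in linear time (`selSpec`), and decides it if it lies inside the current bracket. Rows with half of
the total weight are thereby halved, so at most `3/4` of the candidates survive (`Bracket.round`).

Cost. There are `O(log (n² k))` rounds, each with at most one decision, which gives the second term
of the bound. A round also costs time linear in the number of nonempty rows, which is at most both
`(n + 2)²` and the number `N` of surviving candidates. The sum of these minima is `O(n² log (k +
1))`, not `O(n² log (n² k))`. The potential `searchCost` records both sums. -/

instance (n : ℕ) : OfNat NExpr n := ⟨.const n⟩
instance : Add NExpr := ⟨.add⟩
instance : Sub NExpr := ⟨.sub⟩
instance (n : ℕ) : OfNat RExpr n := ⟨.ofNat (.const n)⟩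
instance : Add RExpr := ⟨.add⟩
instance : Sub RExpr := ⟨.sub⟩
instance : Mul RExpr := ⟨.mul⟩
instance : Div RExpr := ⟨.div⟩
instance : Append Cmd := ⟨.seq⟩

/-- The natural variable number `i`. -/
def N (i : ℕ) : NExpr := .var i
/-- The real variable number `i`. -/
def R (i : ℕ) : RExpr := .var i
/-- The natural memory cell with address `a`. -/
def NM (a : NExpr) : NExpr := .load a
/-- The real memory cell with address `a`. -/
def RM (a : NExpr) : RExpr := .load a

section eval
variable (s : State)

@[simp] theorem NExpr.eval_ofNat (n : ℕ) : (ofNat(n) : NExpr).eval s = OfNat.ofNat n := rfl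
@[simp] theorem NExpr.eval_add' (a b : NExpr) : (a + b).eval s = a.eval s + b.eval s := rfl
@[simp] theorem NExpr.eval_sub' (a b : NExpr) : (a - b).eval s = a.eval s - b.eval s := rfl
@[simp] theorem NExpr.eval_half (a : NExpr) : a.half.eval s = a.eval s / 2 := rfl
@[simp] theorem eval_N (i : ℕ) : (N i).eval s = s.nvar i := rfl
@[simp] theorem eval_NM (a : NExpr) : (NM a).eval s = s.nmem (a.eval s) := rfl
@[simp] theorem RExpr.eval_ofNat (n : ℕ) : (ofNat(n) : RExpr).eval s = ((OfNat.ofNat n : ℕ) : ℝ) := rfl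
@[simp] theorem RExpr.eval_conv (a : NExpr) : (RExpr.ofNat a).eval s = (a.eval s : ℝ) := rfl
@[simp] theorem RExpr.eval_add' (a b : RExpr) : (a + b).eval s = a.eval s + b.eval s := rfl
@[simp] theorem RExpr.eval_sub' (a b : RExpr) : (a - b).eval s = a.eval s - b.eval s := rfl
@[simp] theorem RExpr.eval_mul' (a b : RExpr) : (a * b).eval s = a.eval s * b.eval s := rfl
@[simp] theorem RExpr.eval_div' (a b : RExpr) : (a / b).eval s = a.eval s / b.eval s := rfl
@[simp] theorem RExpr.eval_sqrt (a : RExpr) : a.sqrt.eval s = √(a.eval s) := rfl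
@[simp] theorem RExpr.eval_root (j : ℕ) (a b c d e : RExpr) : (RExpr.root j a b c d e).eval s =
    quarticRoot j (a.eval s) (b.eval s) (c.eval s) (d.eval s) (e.eval s) := rfl
@[simp] theorem eval_R (i : ℕ) : (R i).eval s = s.rvar i := rfl
@[simp] theorem eval_RM (a : NExpr) : (RM a).eval s = s.rmem (a.eval s) := rfl

@[simp] theorem Test.holds_ltN (a b : NExpr) : (Test.ltN a b).holds s ↔ a.eval s < b.eval s := Iff.rfl
@[simp] theorem Test.holds_ltR (a b : RExpr) : (Test.ltR a b).holds s ↔ a.eval s < b.eval s := Iff.rfl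
@[simp] theorem Test.holds_not (b : Test) : (Test.not b).holds s ↔ ¬ b.holds s := Iff.rfl
@[simp] theorem Test.holds_and (b c : Test) : (Test.and b c).holds s ↔ b.holds s ∧ c.holds s :=
  Iff.rfl

end eval

section cost

@[simp] theorem NExpr.cost_ofNat (n : ℕ) : (ofNat(n) : NExpr).cost = 1 := rfl
@[simp] theorem NExpr.cost_add' (a b : NExpr) : (a + b).cost = a.cost + b.cost + 1 := rfl
@[simp] theorem NExpr.cost_sub' (a b : NExpr) : (a - b).cost = a.cost + b.cost + 1 := rfl
@[simp] theorem NExpr.cost_half (a : NExpr) : a.half.cost = a.cost + 1 := rfl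
@[simp] theorem cost_N (i : ℕ) : (N i).cost = 1 := rfl
@[simp] theorem cost_NM (a : NExpr) : (NM a).cost = a.cost + 1 := rfl
@[simp] theorem RExpr.cost_ofNat (n : ℕ) : (ofNat(n) : RExpr).cost = 2 := rfl
@[simp] theorem RExpr.cost_conv (a : NExpr) : (RExpr.ofNat a).cost = a.cost + 1 := rfl
@[simp] theorem RExpr.cost_add' (a b : RExpr) : (a + b).cost = a.cost + b.cost + 1 := rfl
@[simp] theorem RExpr.cost_sub' (a b : RExpr) : (a - b).cost = a.cost + b.cost + 1 := rfl
@[simp] theorem RExpr.cost_mul' (a b : RExpr) : (a * b).cost = a.cost + b.cost + 1 := rfl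
@[simp] theorem RExpr.cost_div' (a b : RExpr) : (a / b).cost = a.cost + b.cost + 1 := rfl
@[simp] theorem RExpr.cost_sqrt (a : RExpr) : a.sqrt.cost = a.cost + 1 := rfl
@[simp] theorem RExpr.cost_root (j : ℕ) (a b c d e : RExpr) : (RExpr.root j a b c d e).cost =
    a.cost + b.cost + c.cost + d.cost + e.cost + 1 := rfl
@[simp] theorem cost_R (i : ℕ) : (R i).cost = 1 := rfl
@[simp] theorem cost_RM (a : NExpr) : (RM a).cost = a.cost + 1 := rfl
@[simp] theorem Test.cost_ltN (a b : NExpr) : (Test.ltN a b).cost = a.cost + b.cost + 1 := rfl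
@[simp] theorem Test.cost_ltR (a b : RExpr) : (Test.ltR a b).cost = a.cost + b.cost + 1 := rfl
@[simp] theorem Test.cost_not (b : Test) : (Test.not b).cost = b.cost + 1 := rfl
@[simp] theorem Test.cost_and (b c : Test) : (Test.and b c).cost = b.cost + c.cost + 1 := rfl

end cost

/-! ### Total correctness with step counts -/

/-- Started in state `s`, the command `c` halts after some number `m` of steps in a state `t` such
that `Q m t`. -/
def Wp (procs : List Cmd) (c : Cmd) (s : State) (Q : ℕ → State → Prop) : Prop :=
  ∃ m t, Exec procs c s m t ∧ Q m t

/-- The values of the variables of a procedure that are set by a list of arguments. -/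
def env {α : Type*} [Zero α] (l : List α) (i : ℕ) : α := l.getD i 0

@[simp] theorem env_zero {α : Type*} [Zero α] (a : α) (l : List α) : env (a :: l) 0 = a := rfl
@[simp] theorem env_one {α : Type*} [Zero α] (a b : α) (l : List α) :
    env (a :: b :: l) 1 = b := rfl
@[simp] theorem env_two {α : Type*} [Zero α] (a b c : α) (l : List α) :
    env (a :: b :: c :: l) 2 = c := rfl
@[simp] theorem env_three {α : Type*} [Zero α] (a b c d : α) (l : List α) :
    env (a :: b :: c :: d :: l) 3 = d := rfl
@[simp] theorem env_four {α : Type*} [Zero α] (a b c d e : α) (l : List α) :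
    env (a :: b :: c :: d :: e :: l) 4 = e := rfl

/-- Procedure number `f`, called with the given arguments and memory, halts after `m` steps with
results `n`, `r` and memory `nm'`, `rm'` such that `Q m n r nm' rm'`. -/
def Call (procs : List Cmd) (f : ℕ) (as : List ℕ) (bs : List ℝ) (nm : ℕ → ℕ) (rm : ℕ → ℝ)
    (Q : ℕ → ℕ → ℝ → (ℕ → ℕ) → (ℕ → ℝ) → Prop) : Prop :=
  ∃ body m t, procs[f]? = some body ∧ Exec procs body ⟨env as, env bs, nm, rm⟩ m t ∧
    Q m (t.nvar 0) (t.rvar 0) t.nmem t.rmem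

variable {procs : List Cmd}

theorem Call.intro {f : ℕ} {body : Cmd} (h : procs[f]? = some body) {as : List ℕ} {bs : List ℝ}
    {nm : ℕ → ℕ} {rm : ℕ → ℝ} {Q : ℕ → ℕ → ℝ → (ℕ → ℕ) → (ℕ → ℝ) → Prop}
    (hw : Wp procs body ⟨env as, env bs, nm, rm⟩
      (fun m t => Q m (t.nvar 0) (t.rvar 0) t.nmem t.rmem)) : Call procs f as bs nm rm Q := by
  obtain ⟨m, t, h1, h2⟩ := hw
  exact ⟨body, m, t, h, h1, h2⟩

theorem Call.mono {f : ℕ} {as : List ℕ} {bs : List ℝ} {nm : ℕ → ℕ} {rm : ℕ → ℝ}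
    {Q Q' : ℕ → ℕ → ℝ → (ℕ → ℕ) → (ℕ → ℝ) → Prop} (h : Call procs f as bs nm rm Q)
    (hQ : ∀ m n r nm' rm', Q m n r nm' rm' → Q' m n r nm' rm') : Call procs f as bs nm rm Q' := by
  obtain ⟨b, m, t, h1, h2, h3⟩ := h
  exact ⟨b, m, t, h1, h2, hQ _ _ _ _ _ h3⟩

theorem Wp.mono {c : Cmd} {s : State} {Q Q' : ℕ → State → Prop} (h : Wp procs c s Q)
    (hQ : ∀ m t, Q m t → Q' m t) : Wp procs c s Q' := by
  obtain ⟨m, t, h1, h2⟩ := h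
  exact ⟨m, t, h1, hQ _ _ h2⟩

-- As simp rules, this and the following equivalences execute code symbolically and add up its cost.
-- `loop` needs no rule: the programs repeat by recursion, and procedures are verified by induction
-- on their arguments.
@[simp] theorem wp_skip (s : State) (Q : ℕ → State → Prop) : Wp procs .skip s Q ↔ Q 1 s :=
  ⟨fun ⟨_, _, h, hQ⟩ => by cases h; exact hQ, fun h => ⟨_, _, .skip s, h⟩⟩

@[simp] theorem wp_setN (s : State) (x : ℕ) (a : NExpr) (Q : ℕ → State → Prop) :
    Wp procs (.setN x a) s Q ↔
      Q (a.cost + 1) ⟨Function.update s.nvar x (a.eval s), s.rvar, s.nmem, s.rmem⟩ :=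
  ⟨fun ⟨_, _, h, hQ⟩ => by cases h; exact hQ, fun h => ⟨_, _, .setN s x a, h⟩⟩

@[simp] theorem wp_setR (s : State) (x : ℕ) (a : RExpr) (Q : ℕ → State → Prop) :
    Wp procs (.setR x a) s Q ↔
      Q (a.cost + 1) ⟨s.nvar, Function.update s.rvar x (a.eval s), s.nmem, s.rmem⟩ :=
  ⟨fun ⟨_, _, h, hQ⟩ => by cases h; exact hQ, fun h => ⟨_, _, .setR s x a, h⟩⟩

@[simp] theorem wp_storeN (s : State) (d a : NExpr) (Q : ℕ → State → Prop) :
    Wp procs (.storeN d a) s Q ↔ Q (d.cost + a.cost + 1)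
      ⟨s.nvar, s.rvar, Function.update s.nmem (d.eval s) (a.eval s), s.rmem⟩ :=
  ⟨fun ⟨_, _, h, hQ⟩ => by cases h; exact hQ, fun h => ⟨_, _, .storeN s d a, h⟩⟩

@[simp] theorem wp_storeR (s : State) (d : NExpr) (a : RExpr) (Q : ℕ → State → Prop) :
    Wp procs (.storeR d a) s Q ↔ Q (d.cost + a.cost + 1)
      ⟨s.nvar, s.rvar, s.nmem, Function.update s.rmem (d.eval s) (a.eval s)⟩ :=
  ⟨fun ⟨_, _, h, hQ⟩ => by cases h; exact hQ, fun h => ⟨_, _, .storeR s d a, h⟩⟩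

@[simp] theorem wp_seq (c d : Cmd) (s : State) (Q : ℕ → State → Prop) :
    Wp procs (c ++ d) s Q ↔ Wp procs c s (fun m t => Wp procs d t (fun l r => Q (m + l) r)) := by
  constructor
  · rintro ⟨_, _, h, hQ⟩
    cases h with
    | seq h1 h2 => exact ⟨_, _, h1, _, _, h2, hQ⟩
  · rintro ⟨_, _, h1, _, _, h2, hQ⟩
    exact ⟨_, _, .seq h1 h2, hQ⟩

open scoped Classical in
@[simp] theorem wp_cond (b : Test) (c d : Cmd) (s : State) (Q : ℕ → State → Prop) :
    Wp procs (.cond b c d) s Q ↔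
      if b.holds s then Wp procs c s (fun m t => Q (b.cost + m + 1) t)
      else Wp procs d s (fun m t => Q (b.cost + m + 1) t) := by
  constructor
  · rintro ⟨_, _, h, hQ⟩
    cases h with
    | condTrue hb h1 => rw [if_pos hb]; exact ⟨_, _, h1, hQ⟩
    | condFalse hb h1 => rw [if_neg hb]; exact ⟨_, _, h1, hQ⟩
  · intro h
    split_ifs at h with hb
    · obtain ⟨_, _, h1, hQ⟩ := h
      exact ⟨_, _, .condTrue hb h1, hQ⟩
    · obtain ⟨_, _, h1, hQ⟩ := h
      exact ⟨_, _, .condFalse hb h1, hQ⟩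

@[simp] theorem wp_call (x u f : ℕ) (as : List NExpr) (bs : List RExpr) (s : State)
    (Q : ℕ → State → Prop) :
    Wp procs (.call x u f as bs) s Q ↔
      Call procs f (as.map (NExpr.eval s)) (bs.map (RExpr.eval s)) s.nmem s.rmem
        (fun m n r nm rm => Q ((as.map NExpr.cost).sum + (bs.map RExpr.cost).sum + m + 1)
          ⟨Function.update s.nvar x n, Function.update s.rvar u r, nm, rm⟩) := by
  constructor
  · rintro ⟨_, _, h, hQ⟩
    cases h with
    | call h1 h2 => exact ⟨_, _, _, h1, h2, hQ⟩
  · rintro ⟨_, _, _, h1, h2, hQ⟩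
    exact ⟨_, _, .call h1 h2, hQ⟩

/-! ### Reading arrays -/

/-- The pairs (real cell, natural cell) with the `len` addresses from `b` on. -/
def arr (nm : ℕ → ℕ) (rm : ℕ → ℝ) : ℕ → ℕ → List (ℝ × ℕ)
  | _, 0 => []
  | b, len + 1 => (rm b, nm b) :: arr nm rm (b + 1) len

@[simp] theorem arr_zero (nm : ℕ → ℕ) (rm : ℕ → ℝ) (b : ℕ) : arr nm rm b 0 = [] := rfl
@[simp] theorem arr_succ (nm : ℕ → ℕ) (rm : ℕ → ℝ) (b len : ℕ) :
    arr nm rm b (len + 1) = (rm b, nm b) :: arr nm rm (b + 1) len := rfl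

@[simp] theorem length_arr (nm : ℕ → ℕ) (rm : ℕ → ℝ) (b len : ℕ) :
    (arr nm rm b len).length = len := by
  induction len generalizing b with
  | zero => rfl
  | succ len ih => simp [ih]

theorem arr_congr {nm nm' : ℕ → ℕ} {rm rm' : ℕ → ℝ} {b len : ℕ}
    (hn : ∀ a, b ≤ a → a < b + len → nm' a = nm a) (hr : ∀ a, b ≤ a → a < b + len → rm' a = rm a) :
    arr nm' rm' b len = arr nm rm b len := by
  induction len generalizing b with
  | zero => rfl
  | succ len ih =>
    rw [arr_succ, arr_succ, hn b le_rfl (by omega), hr b le_rfl (by omega),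
      ih (fun a h1 h2 => hn a (by omega) (by omega)) (fun a h1 h2 => hr a (by omega) (by omega))]

/-! ### Weighted selection in linear time -/

/-- Procedure 0: the total weight of the entries `x` of an array with `s * x < s * v`. -/
def weighBody : Cmd :=
  .cond (.ltN 0 (N 1))
    (.call 2 2 0 [N 0 + 1, N 1 - 1] [R 0, R 1] ++
      .cond (.ltR (R 1 * RM (N 0)) (R 1 * R 0)) (.setN 0 (N 2 + NM (N 0))) (.setN 0 (N 2)))
    (.setN 0 0)

/-- Procedure 1: copies the entries `x` of an array with `s * x < s * v` and counts them. -/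
def filtBody : Cmd :=
  .cond (.ltN 0 (N 1))
    (.cond (.ltR (R 1 * RM (N 0)) (R 1 * R 0))
      (.storeR (N 2) (RM (N 0)) ++ .storeN (N 2) (NM (N 0)) ++
        .call 3 2 1 [N 0 + 1, N 1 - 1, N 2 + 1] [R 0, R 1] ++ .setN 0 (N 3 + 1))
      (.call 0 2 1 [N 0 + 1, N 1 - 1, N 2] [R 0, R 1]))
    (.setN 0 0)

open scoped Classical in
-- The sign `sg = ±1` makes one procedure serve for the entries below `v` and for those above `v`.
theorem call_weigh (h0 : procs[0]? = some weighBody) (len b : ℕ) (v sg : ℝ) (nm : ℕ → ℕ)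
    (rm : ℕ → ℝ) :
    Call procs 0 [b, len] [v, sg] nm rm (fun m n _ nm' rm' => nm' = nm ∧ rm' = rm ∧
      n = (((arr nm rm b len).filter (fun x => sg * x.1 < sg * v)).map Prod.snd).sum ∧
      m ≤ 50 * (len + 1)) := by
  induction len generalizing b with
  | zero =>
    refine Call.intro h0 ?_
    simp [weighBody]
  | succ len ih =>
    refine Call.intro h0 ?_
    simp [weighBody]
    refine (ih (b + 1)).mono ?_
    rintro m n r nm' rm' ⟨rfl, rfl, rfl, hm⟩
    split_ifs with h
    · refine ⟨rfl, rfl, ?_, by omega⟩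
      simp [h, add_comm]
    · refine ⟨rfl, rfl, ?_, by omega⟩
      simp [h]

open scoped Classical in
theorem call_filt (h1 : procs[1]? = some filtBody) (len b d : ℕ) (hd : b + len ≤ d) (v sg : ℝ)
    (nm : ℕ → ℕ) (rm : ℕ → ℝ) :
    Call procs 1 [b, len, d] [v, sg] nm rm (fun m n _ nm' rm' =>
      (∀ a < d, nm' a = nm a) ∧ (∀ a < d, rm' a = rm a) ∧
      arr nm' rm' d n = (arr nm rm b len).filter (fun x => sg * x.1 < sg * v) ∧
      m ≤ 50 * (len + 1)) := by
  induction len generalizing b d nm rm with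
  | zero =>
    refine Call.intro h1 ?_
    simp [filtBody]
  | succ len ih =>
    refine Call.intro h1 ?_
    simp [filtBody]
    split_ifs with h
    · refine (ih (b + 1) (d + 1) (by omega) _ _).mono ?_
      rintro m n r nm' rm' ⟨hn, hr, ha, hm⟩
      refine ⟨fun a h => ?_, fun a h => ?_, ?_, by omega⟩
      · rw [hn a (by omega), Function.update_of_ne (by omega)]
      · rw [hr a (by omega), Function.update_of_ne (by omega)]
      · simp only [ha]
        rw [hn d (by omega), hr d (by omega), List.filter_cons_of_pos (by simpa using h)]
        simp only [Function.update_self]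
        rw [arr_congr (nm := nm) (rm := rm)] <;>
        · intro a h1 h2
          rw [Function.update_of_ne (by omega)]
    · refine (ih (b + 1) d (by omega) _ _).mono ?_
      rintro m n r nm' rm' ⟨hn, hr, ha, hm⟩
      refine ⟨hn, hr, ?_, by omega⟩
      rw [ha, List.filter_cons_of_neg (by simpa using h)]

/-- The smaller of two real numbers. -/
def RExpr.mn (a b : RExpr) : RExpr := (a + b - ((a - b) * (a - b)).sqrt) / 2
/-- The larger of two real numbers. -/
def RExpr.mx (a b : RExpr) : RExpr := (a + b + ((a - b) * (a - b)).sqrt) / 2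
/-- The median of three real numbers. -/
def RExpr.med (a b c : RExpr) : RExpr := .mx (.mn a b) (.mn (.mx a b) c)

@[simp] theorem RExpr.cost_mn (a b : RExpr) : (a.mn b).cost = 3 * a.cost + 3 * b.cost + 9 := by
  simp [mn]; ring

@[simp] theorem RExpr.cost_mx (a b : RExpr) : (a.mx b).cost = 3 * a.cost + 3 * b.cost + 9 := by
  simp [mx]; ring

-- `√((a - b)²) = |a - b|` gives minimum, maximum and medians without branching, so that the
-- pseudomedian of nine is a single expression of constant cost.
@[simp] theorem RExpr.eval_mn (s : State) (a b : RExpr) :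
    (a.mn b).eval s = min (a.eval s) (b.eval s) := by
  have : (a.mn b).eval s = (a.eval s + b.eval s - |a.eval s - b.eval s|) / 2 := by
    simp [mn, Real.sqrt_mul_self_eq_abs]
  rw [this]
  rcases le_total (a.eval s) (b.eval s) with h | h
  · rw [min_eq_left h, abs_of_nonpos (by linarith)]; ring
  · rw [min_eq_right h, abs_of_nonneg (by linarith)]; ring

@[simp] theorem RExpr.eval_mx (s : State) (a b : RExpr) :
    (a.mx b).eval s = max (a.eval s) (b.eval s) := by
  have : (a.mx b).eval s = (a.eval s + b.eval s + |a.eval s - b.eval s|) / 2 := by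
    simp [mx, Real.sqrt_mul_self_eq_abs]
  rw [this]
  rcases le_total (a.eval s) (b.eval s) with h | h
  · rw [max_eq_right h, abs_of_nonpos (by linarith)]; ring
  · rw [max_eq_left h, abs_of_nonneg (by linarith)]; ring

/-- The median of three real numbers. -/
noncomputable def med3 (a b c : ℝ) : ℝ := max (min a b) (min (max a b) c)

@[simp] theorem RExpr.eval_med (s : State) (a b c : RExpr) :
    (a.med b c).eval s = med3 (a.eval s) (b.eval s) (c.eval s) := by
  simp [med, med3]

theorem med3_le {a b c v : ℝ} (h : med3 a b c ≤ v) :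
    (a ≤ v ∧ b ≤ v) ∨ (a ≤ v ∧ c ≤ v) ∨ (b ≤ v ∧ c ≤ v) := by
  simp only [med3, max_le_iff, min_le_iff] at h
  tauto

theorem le_med3 {a b c v : ℝ} (h : v ≤ med3 a b c) :
    (v ≤ a ∧ v ≤ b) ∨ (v ≤ a ∧ v ≤ c) ∨ (v ≤ b ∧ v ≤ c) := by
  simp only [med3, le_max_iff, le_min_iff] at h
  tauto

open scoped Classical in
theorem two_le_of_majority {p q r : Prop} (h : (p ∧ q) ∨ (p ∧ r) ∨ (q ∧ r)) :
    2 ≤ (if p then 1 else 0) + (if q then 1 else 0) + (if r then 1 else 0) := by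
  rcases h with ⟨h1, h2⟩ | ⟨h1, h2⟩ | ⟨h1, h2⟩ <;> simp only [h1, h2, if_true] <;> omega

open scoped Classical in
-- If `P` passes from a median of three to two of its arguments, it passes from the outer median to
-- two of the inner ones, and from each of these to two entries.
theorem four_le_of_majority {P : ℝ → Prop}
    (hP : ∀ {a b c}, P (med3 a b c) → (P a ∧ P b) ∨ (P a ∧ P c) ∨ (P b ∧ P c))
    {a b c d e f g h i : ℝ} (H : P (med3 (med3 a b c) (med3 d e f) (med3 g h i))) :
    4 ≤ (if P a then 1 else 0) + (if P b then 1 else 0) + (if P c then 1 else 0) +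
      ((if P d then 1 else 0) + (if P e then 1 else 0) + (if P f then 1 else 0)) +
      ((if P g then 1 else 0) + (if P h then 1 else 0) + (if P i then 1 else 0)) := by
  rcases hP H with ⟨h1, h2⟩ | ⟨h1, h2⟩ | ⟨h1, h2⟩ <;>
  · have := two_le_of_majority (hP h1)
    have := two_le_of_majority (hP h2)
    omega

/-- The pseudomedian of nine consecutive real cells. -/
def nineE : RExpr :=
  .med (.med (RM (N 0)) (RM (N 0 + 1)) (RM (N 0 + 2)))
    (.med (RM (N 0 + 3)) (RM (N 0 + 4)) (RM (N 0 + 5)))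
    (.med (RM (N 0 + 6)) (RM (N 0 + 7)) (RM (N 0 + 8)))

/-- Procedure 2: writes the pseudomedians of the consecutive groups of nine entries of an array,
with weights `1`. -/
def med9Body : Cmd :=
  .cond (.ltN (N 1) 9) (.setN 0 0)
    (.storeR (N 2) nineE ++ .storeN (N 2) 1 ++
      .call 3 2 2 [N 0 + 9, N 1 - 9, N 2 + 1] [] ++ .setN 0 (N 3 + 1))

open scoped Classical in
-- Quantifying over `P` lets a single run serve for both `(· ≤ v)` and `(v ≤ ·)`. The last `len % 9`
-- entries are ignored, which only weakens the inequality.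
theorem call_med9 (h2 : procs[2]? = some med9Body) (len b d : ℕ) (hd : b + len ≤ d)
    (nm : ℕ → ℕ) (rm : ℕ → ℝ) :
    Call procs 2 [b, len, d] [] nm rm (fun m n _ nm' rm' =>
      (∀ a < d, nm' a = nm a) ∧ (∀ a < d, rm' a = rm a) ∧ n = len / 9 ∧
      (∀ x ∈ arr nm' rm' d n, x.2 = 1) ∧
      (∀ P : ℝ → Prop, (∀ {a b c}, P (med3 a b c) → (P a ∧ P b) ∨ (P a ∧ P c) ∨ (P b ∧ P c)) →
        4 * (arr nm' rm' d n).countP (fun x => P x.1) ≤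
          (arr nm rm b len).countP (fun x => P x.1)) ∧
      m ≤ (nineE.cost + 50) * (len + 1)) := by
  induction len using Nat.strong_induction_on generalizing b d nm rm with
  | _ len ih =>
  refine Call.intro h2 ?_
  by_cases h9 : len < 9
  · simp [med9Body, h9, Nat.div_eq_of_lt h9]
    exact le_trans (by omega) (Nat.le_mul_of_pos_right _ (by omega))
  · obtain ⟨l, rfl⟩ : ∃ l, len = l + 9 := ⟨len - 9, by omega⟩
    have harr : arr nm rm b (l + 9) = (rm b, nm b) :: (rm (b + 1), nm (b + 1)) ::
      (rm (b + 2), nm (b + 2)) :: (rm (b + 3), nm (b + 3)) :: (rm (b + 4), nm (b + 4)) ::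
      (rm (b + 5), nm (b + 5)) :: (rm (b + 6), nm (b + 6)) :: (rm (b + 7), nm (b + 7)) ::
      (rm (b + 8), nm (b + 8)) :: arr nm rm (b + 9) l := rfl
    simp only [harr]
    simp [med9Body]
    refine (ih l (by omega) (b + 9) (d + 1) (by omega) _ _).mono ?_
    rintro m n r nm' rm' ⟨hn, hr, rfl, h1, hP, hm⟩
    refine ⟨fun a h => ?_, fun a h => ?_, by omega, ?_, ?_, by nlinarith⟩
    · rw [hn a (by omega), Function.update_of_ne (by omega)]
    · rw [hr a (by omega), Function.update_of_ne (by omega)]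
    · rw [hn d (by omega), Function.update_self]
      rintro x y (⟨-, rfl⟩ | h)
      exacts [rfl, h1 _ h]
    · intro P hmaj
      have := hP P hmaj
      rw [arr_congr (nm := nm) (rm := rm) (nm' := Function.update nm d 1) (b := b + 9)
        (fun a h1 h2 => by rw [Function.update_of_ne (by omega)])
        (fun a h1 h2 => by rw [Function.update_of_ne (by omega)])] at this
      have key := @four_le_of_majority P hmaj (rm b) (rm (b + 1)) (rm (b + 2)) (rm (b + 3))
        (rm (b + 4)) (rm (b + 5)) (rm (b + 6)) (rm (b + 7)) (rm (b + 8))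
      simp only [List.countP_cons, decide_eq_true_eq, hr d (by omega), Function.update_self,
        nineE, RExpr.eval_med, eval_RM, eval_N, NExpr.eval_add', env_zero, NExpr.eval_ofNat] at this ⊢
      by_cases h : P (med3 (med3 (rm b) (rm (b + 1)) (rm (b + 2)))
        (med3 (rm (b + 3)) (rm (b + 4)) (rm (b + 5))) (med3 (rm (b + 6)) (rm (b + 7)) (rm (b + 8))))
      · have := key h
        rw [if_pos h]
        omega
      · rw [if_neg h]
        omega

/-! ### Weights of lists, and the correctness of the selection -/

open scoped Classical in
/-- The total weight of the entries of `l` with a property `P`. -/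
noncomputable def wt (l : List (ℝ × ℕ)) (P : ℝ → Prop) : ℕ :=
  ((l.filter (fun x => P x.1)).map Prod.snd).sum

@[simp] theorem wt_nil (P : ℝ → Prop) : wt [] P = 0 := rfl

open scoped Classical in
theorem wt_cons (x : ℝ × ℕ) (l : List (ℝ × ℕ)) (P : ℝ → Prop) :
    wt (x :: l) P = (if P x.1 then x.2 else 0) + wt l P := by
  unfold wt
  split_ifs with h
  · rw [List.filter_cons_of_pos (by simpa using h)]; simp
  · rw [List.filter_cons_of_neg (by simpa using h)]; simp

theorem wt_mono {l : List (ℝ × ℕ)} {P Q : ℝ → Prop} (h : ∀ x, P x → Q x) : wt l P ≤ wt l Q := by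
  induction l with
  | nil => simp
  | cons x l ih =>
    rw [wt_cons, wt_cons]
    refine Nat.add_le_add ?_ ih
    split_ifs with h1 h2 <;> first | omega | exact absurd (h _ h1) h2

theorem wt_congr {l : List (ℝ × ℕ)} {P Q : ℝ → Prop} (h : ∀ x, P x ↔ Q x) : wt l P = wt l Q :=
  le_antisymm (wt_mono fun x => (h x).1) (wt_mono fun x => (h x).2)

theorem wt_true (l : List (ℝ × ℕ)) : wt l (fun _ => True) = (l.map Prod.snd).sum := by
  simp [wt]

theorem wt_add_of_disjoint {l : List (ℝ × ℕ)} {P Q U : ℝ → Prop} (h : ∀ x, U x ↔ P x ∨ Q x)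
    (hd : ∀ x, P x → ¬ Q x) : wt l U = wt l P + wt l Q := by
  induction l with
  | nil => simp
  | cons x l ih =>
    rw [wt_cons, wt_cons, wt_cons, ih]
    have h1 := h x.1
    have h2 := hd x.1
    split_ifs <;> first | omega | tauto

theorem wt_filter (l : List (ℝ × ℕ)) (P Q : ℝ → Prop) [DecidablePred Q] :
    wt (l.filter (fun x => Q x.1)) P = wt l (fun x => Q x ∧ P x) := by
  classical
  induction l with
  | nil => simp
  | cons x l ih =>
    by_cases h : Q x.1
    · rw [List.filter_cons_of_pos (by simpa using h), wt_cons, wt_cons, ih]; congr 1; simp [h]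
    · rw [List.filter_cons_of_neg (by simpa using h), wt_cons, ih]; simp [h]

open scoped Classical in
theorem wt_eq_countP {l : List (ℝ × ℕ)} (h : ∀ x ∈ l, x.2 = 1) (P : ℝ → Prop) :
    wt l P = l.countP (fun x => P x.1) := by
  induction l with
  | nil => simp
  | cons x l ih =>
    rw [wt_cons, ih fun y hy => h y (List.mem_cons_of_mem _ hy), List.countP_cons,
      h x List.mem_cons_self, add_comm]
    simp

open scoped Classical in
theorem countP_add_countP_not (l : List (ℝ × ℕ)) (P Q : ℝ → Prop) (h : ∀ x, P x ↔ ¬ Q x) :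
    l.countP (fun x => P x.1) + l.countP (fun x => Q x.1) = l.length := by
  induction l with
  | nil => simp
  | cons x l ih =>
    have h1 := h x.1
    simp only [List.countP_cons, List.length_cons, decide_eq_true_eq]
    split_ifs <;> first | omega | tauto

theorem call_weigh_wt (h0 : procs[0]? = some weighBody) (len b : ℕ) (v sg : ℝ) (P : ℝ → Prop)
    (hP : ∀ x, sg * x < sg * v ↔ P x) (nm : ℕ → ℕ) (rm : ℕ → ℝ) :
    Call procs 0 [b, len] [v, sg] nm rm (fun m n _ nm' rm' => nm' = nm ∧ rm' = rm ∧
      n = wt (arr nm rm b len) P ∧ m ≤ 50 * (len + 1)) := by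
  refine (call_weigh h0 len b v sg nm rm).mono ?_
  rintro m n r nm' rm' ⟨h1, h2, h3, h4⟩
  exact ⟨h1, h2, h3.trans (wt_congr hP), h4⟩

open scoped Classical in
theorem call_filt_prop (h1 : procs[1]? = some filtBody) (len b d : ℕ) (hd : b + len ≤ d)
    (v sg : ℝ) (P : ℝ → Prop) (hP : ∀ x, sg * x < sg * v ↔ P x) (nm : ℕ → ℕ) (rm : ℕ → ℝ) :
    Call procs 1 [b, len, d] [v, sg] nm rm (fun m n _ nm' rm' =>
      (∀ a < d, nm' a = nm a) ∧ (∀ a < d, rm' a = rm a) ∧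
      arr nm' rm' d n = (arr nm rm b len).filter (fun x => P x.1) ∧ m ≤ 50 * (len + 1)) := by
  refine (call_filt h1 len b d hd v sg nm rm).mono ?_
  rintro m n r nm' rm' ⟨h1, h2, h3, h4⟩
  refine ⟨h1, h2, h3.trans (List.filter_congr fun x _ => ?_), h4⟩
  simp [hP]

/-- Procedure 3: the weighted selection.  The first command finds a pivot. -/
def pivotCmd : Cmd :=
  .cond (.ltN (N 1) 9) (.setR 0 (RM (N 0)))
    (.call 4 1 2 [N 0, N 1, N 0 + N 1] [] ++
      .call 5 0 3 [N 0 + N 1, N 4, N 4, (N 4).half] [])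

def partitionCmd : Cmd :=
  .call 5 1 0 [N 0, N 1] [R 0, 1] ++
    .cond (.ltN (N 3) (N 5))
      (.call 6 1 1 [N 0, N 1, N 0 + N 1] [R 0, 1] ++ .call 7 0 3 [N 0 + N 1, N 6, N 5, N 3] [])
      (.call 6 1 0 [N 0, N 1] [R 0, 0 - 1] ++
        .cond (.ltN (N 3) (N 2 - N 6)) .skip
          (.call 7 1 1 [N 0, N 1, N 0 + N 1] [R 0, 0 - 1] ++
            .call 8 0 3 [N 0 + N 1, N 7, N 6, N 3 - (N 2 - N 6)] []))

def selBody : Cmd := pivotCmd ++ partitionCmd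

/-- A bound for the steps of the selection per entry. -/
def selCost : ℕ := 18 * (nineE.cost + 500)

/-- The specification of the selection procedure. -/
def SelSpec (procs : List Cmd) (len : ℕ) : Prop :=
  ∀ (b W τ : ℕ) (nm : ℕ → ℕ) (rm : ℕ → ℝ), ((arr nm rm b len).map Prod.snd).sum = W → τ < W →
    Call procs 3 [b, len, W, τ] [] nm rm (fun m _ r nm' rm' =>
      (∀ a < b + len, nm' a = nm a) ∧ (∀ a < b + len, rm' a = rm a) ∧
      wt (arr nm rm b len) (· < r) ≤ τ ∧ τ < wt (arr nm rm b len) (· ≤ r) ∧ m ≤ selCost * len)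

open scoped Classical in
-- The pivot is a median of the `len / 9` pseudomedians, found recursively. On either side of it lie
-- at least half of them, and each accounts for four entries; hence `2 * (len / 9)`.
theorem wp_pivot (h2 : procs[2]? = some med9Body) (len b W τ : ℕ) (hlen : 1 ≤ len)
    (ih : ∀ l < len, SelSpec procs l) (nm : ℕ → ℕ) (rm : ℕ → ℝ) :
    Wp procs pivotCmd ⟨env [b, len, W, τ], env [], nm, rm⟩ (fun m t =>
      t.nvar 0 = b ∧ t.nvar 1 = len ∧ t.nvar 2 = W ∧ t.nvar 3 = τ ∧
      (∀ a < b + len, t.nmem a = nm a) ∧ (∀ a < b + len, t.rmem a = rm a) ∧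
      (∃ v, t.rvar 0 = v ∧
        (if len < 9 then 1 else 2 * (len / 9)) ≤ (arr nm rm b len).countP (fun x => x.1 ≤ v) ∧
        (if len < 9 then 1 else 2 * (len / 9)) ≤ (arr nm rm b len).countP (fun x => v ≤ x.1)) ∧
      m ≤ (nineE.cost + 150) * (len + 1) + if len < 9 then 0 else selCost * (len / 9)) := by
  by_cases h9 : len < 9
  · obtain ⟨l, rfl⟩ : ∃ l, len = l + 1 := ⟨len - 1, by omega⟩
    simp [pivotCmd, h9]
    nlinarith
  · simp [pivotCmd, h9]
    refine (call_med9 h2 len b (b + len) le_rfl nm rm).mono ?_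
    rintro m n r nm' rm' ⟨hn, hr, rfl, h1, hP, hm⟩
    have hsum : ((arr nm' rm' (b + len) (len / 9)).map Prod.snd).sum = len / 9 := by
      rw [← wt_true, wt_eq_countP h1]
      simp
    refine (ih (len / 9) (by omega) (b + len) (len / 9) (len / 9 / 2) nm' rm' hsum
      (by omega)).mono ?_
    rintro m' n' v nm'' rm'' ⟨hn', hr', hlt, hle, hm'⟩
    rw [wt_eq_countP h1] at hlt hle
    have hc := countP_add_countP_not (arr nm' rm' (b + len) (len / 9)) (· < v) (v ≤ ·)
      (fun x => not_le.symm)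
    have e1 := hP (· ≤ v) med3_le
    have e2 := hP (v ≤ ·) le_med3
    rw [length_arr] at hc
    refine ⟨fun a h => ?_, fun a h => ?_, ⟨by omega, by omega⟩, by nlinarith⟩
    · rw [hn' a (by omega), hn a h]
    · rw [hr' a (by omega), hr a h]

open scoped Classical in
-- The recursive calls have sizes `len / 9` for the pivot and at most `len - 2 * (len / 9)` for the
-- part that contains the answer. Together they fall short of `len` by at least `len / 9`, and
-- `selCost * (len / 9)` pays for the linear work. The weights only decide which part is kept; its
-- size is controlled by the unweighted pivot.
theorem selSpec (h0 : procs[0]? = some weighBody) (h1 : procs[1]? = some filtBody)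
    (h2 : procs[2]? = some med9Body) (h3 : procs[3]? = some selBody) (len : ℕ) :
    SelSpec procs len := by
  induction len using Nat.strong_induction_on with
  | _ len ih =>
  intro b W τ nm rm hW hτ
  have hlen : 1 ≤ len := by
    rcases len with _ | len
    · simp at hW; omega
    · omega
  refine Call.intro h3 ?_
  rw [selBody, wp_seq]
  refine (wp_pivot h2 len b W τ hlen ih nm rm).mono ?_
  rintro m0 ⟨nv, rv, nm0, rm0⟩ ⟨e0, e1, e2, e3, hn0, hr0, ⟨v, hv, hle, hge⟩, hm0⟩
  simp only at e0 e1 e2 e3 hn0 hr0 hv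
  have harr : arr nm0 rm0 b len = arr nm rm b len :=
    arr_congr (fun a h1 h2 => hn0 a h2) (fun a h1 h2 => hr0 a h2)
  set l := arr nm rm b len with hl
  have hll : l.length = len := length_arr _ _ _ _
  simp only [partitionCmd, wp_seq, wp_call, List.map_cons, List.map_nil, eval_N, eval_R, e0, e1,
    RExpr.eval_ofNat]
  rw [hv]
  refine (call_weigh_wt h0 len b v _ (· < v) (by simp) nm0 rm0).mono ?_
  rintro m1 n1 r1 nm' rm' ⟨rfl, rfl, hn1, hm1⟩
  rw [harr] at hn1
  have hall : wt l (· ≤ v) + wt l (v < ·) = W := by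
    rw [← wt_add_of_disjoint (U := fun _ => True) (fun x => by simp [le_or_gt])
      (fun x hx => not_lt.2 hx), wt_true, hW]
  have hc1 := countP_add_countP_not l (· ≤ v) (v < ·) (fun x => not_lt.symm)
  have hc2 := countP_add_countP_not l (v ≤ ·) (· < v) (fun x => not_lt.symm)
  have hcost : ∀ n, n + (if len < 9 then 1 else 2 * (len / 9)) ≤ len →
      (nineE.cost + 450) * (len + 1) + (if len < 9 then 0 else selCost * (len / 9)) +
        selCost * n ≤ selCost * len := by
    intro n hn
    unfold selCost
    split_ifs at hn ⊢
    · nlinarith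
    -- Equality holds for `len = 17`; this is where the factor `18` in `selCost` comes from.
    · have : len + 1 ≤ 18 * (len / 9) := by omega
      nlinarith
  have hcost0 := hcost 0 (by split_ifs <;> omega)
  rw [Nat.mul_zero] at hcost0
  simp only [Nat.add_mul nineE.cost] at hcost hcost0 hm0
  simp [e0, e1, e2, e3, hv]
  split_ifs with hcase
  · refine (call_filt_prop h1 len b (b + len) le_rfl v 1 (· < v) (by simp) nm' rm').mono ?_
    rintro m2 n2 r2 nm2 rm2 ⟨hn2, hr2, ha2, hm2⟩
    rw [harr] at ha2
    have hlen2 : n2 = l.countP (fun x => x.1 < v) := by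
      rw [List.countP_eq_length_filter, ← ha2, length_arr]
    refine (ih n2 (by split_ifs at hge <;> omega) (b + len) n1 τ nm2 rm2 ?_ hcase).mono ?_
    · rw [ha2, hn1]; rfl
    rintro m3 n3 r3 nm3 rm3 ⟨hn3, hr3, hlt3, hle3, hm3⟩
    rw [ha2, @wt_filter l _ (· < v) _] at hlt3 hle3
    -- Otherwise all entries below `v`, whose weight exceeds `τ`, would be below `r3`.
    have hr3v : r3 < v := by
      by_contra hcon
      have := wt_mono (l := l) (P := (· < v)) (Q := fun x => x < v ∧ x < r3)
        (fun x hx => ⟨hx, hx.trans_le (not_lt.1 hcon)⟩)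
      omega
    refine ⟨fun a h => ?_, fun a h => ?_, ?_, ?_, ?_⟩
    · rw [hn3 a (by omega), hn2 a h, hn0 a h]
    · rw [hr3 a (by omega), hr2 a h, hr0 a h]
    · exact (wt_mono fun x hx => ⟨lt_trans hx hr3v, hx⟩).trans hlt3
    · exact hle3.trans_le (wt_mono fun x hx => hx.2)
    · have := hcost n2 (by omega)
      omega
  · refine (call_weigh_wt h0 len b v (-1) (v < ·) (by simp) nm' rm').mono ?_
    rintro m2 n2 r2 nm2 rm2 ⟨rfl, rfl, hn2, hm2⟩
    rw [harr] at hn2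
    split_ifs with hcase2
    · exact ⟨hn0, hr0, by omega, by omega, by omega⟩
    · refine (call_filt_prop h1 len b (b + len) le_rfl v (-1) (v < ·) (by simp) nm2 rm2).mono ?_
      rintro m4 n4 r4 nm4 rm4 ⟨hn4, hr4, ha4, hm4⟩
      rw [harr] at ha4
      have hlen4 : n4 = l.countP (fun x => v < x.1) := by
        rw [List.countP_eq_length_filter, ← ha4, length_arr]
      refine (ih n4 (by split_ifs at hle <;> omega) (b + len) n2 (τ - (W - n2)) nm4 rm4 ?_
        (by omega)).mono ?_
      · rw [ha4, hn2]; rfl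
      rintro m3 n3 r3 nm3 rm3 ⟨hn3, hr3, hlt3, hle3, hm3⟩
      rw [ha4, @wt_filter l _ (v < ·) _] at hlt3 hle3
      -- Otherwise no entry above `v` would be at most `r3`, against `hle3`.
      have hr3v : v < r3 := by
        by_contra hcon
        have : wt l (fun x => v < x ∧ x ≤ r3) ≤ wt l (fun x => x ≤ v ∧ v < x) :=
          wt_mono fun x hx => absurd (hx.1.trans_le hx.2) hcon
        have h' := wt_add_of_disjoint (l := l) (P := fun x => x ≤ v ∧ v < x) (Q := (v < ·))
          (U := (v < ·)) (fun x => by tauto) (fun x hx => absurd hx.2 (not_lt.2 hx.1))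
        omega
      have k1 := wt_add_of_disjoint (l := l) (P := (· ≤ v)) (Q := fun x => v < x ∧ x < r3)
        (U := (· < r3)) (fun x => ⟨fun hx => by
          rcases le_or_gt x v with h | h
          exacts [.inl h, .inr ⟨h, hx⟩], fun hx => hx.elim (fun h => h.trans_lt hr3v) (·.2)⟩)
        (fun x hx h => absurd h.1 (not_lt.2 hx))
      have k2 := wt_add_of_disjoint (l := l) (P := (· ≤ v)) (Q := fun x => v < x ∧ x ≤ r3)
        (U := (· ≤ r3)) (fun x => ⟨fun hx => by
          rcases le_or_gt x v with h | h
          exacts [.inl h, .inr ⟨h, hx⟩], fun hx => hx.elim (fun h => h.trans hr3v.le) (·.2)⟩)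
        (fun x hx h => absurd h.1 (not_lt.2 hx))
      refine ⟨fun a h => ?_, fun a h => ?_, by omega, by omega, ?_⟩
      · rw [hn3 a (by omega), hn4 a h, hn0 a h]
      · rw [hr3 a (by omega), hr4 a h, hr0 a h]
      · have := hcost n4 (by omega)
        omega

/-! ### The decision procedure -/

/-- Procedure 4: binary search for the number of centers that fit into a segment. -/
def bsearchBody : Cmd :=
  .cond (.ltN (N 0) (N 1))
    (.setN 2 (N 0 + N 1 + 1).half ++
      .cond (.ltR (R 0) (R 1 + .ofNat (N 2 - 1) * R 2))
        (.call 0 3 4 [N 0, N 2 - 1] [R 0, R 1, R 2])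
        (.call 0 3 4 [N 2, N 1] [R 0, R 1, R 2]))
    .skip

/-- `n` centers at spacing `σ` span `(n - 1) * σ`, so they fit into `[M, Y]` iff `M + (n - 1) * σ ≤
Y`. The result is the largest such `n`, confined to `[lo, hi]`; the search replaces a floor function
and also covers `σ = 0`. -/
theorem call_bsearch (h4 : procs[4]? = some bsearchBody) (Y M σ : ℝ) (nm : ℕ → ℕ) (rm : ℕ → ℝ)
    (s lo hi : ℕ) (hle : lo ≤ hi) (hs : hi - lo < 2 ^ s) :
    Call procs 4 [lo, hi] [Y, M, σ] nm rm (fun m n _ nm' rm' => nm' = nm ∧ rm' = rm ∧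
      lo ≤ n ∧ n ≤ hi ∧ (n = lo ∨ M + (n - 1 : ℕ) * σ ≤ Y) ∧ (n = hi ∨ Y < M + n * σ) ∧
      m ≤ 50 * (s + 1)) := by
  induction s generalizing lo hi with
  | zero =>
    obtain rfl : lo = hi := by simp at hs; omega
    refine Call.intro h4 ?_
    simp [bsearchBody]
  | succ s ih =>
    refine Call.intro h4 ?_
    by_cases hlt : lo < hi
    · simp [bsearchBody, hlt]
      rw [pow_succ] at hs
      -- The midpoint is rounded up, so it exceeds `lo`: the truncated subtraction is exact and both
      -- halves are shorter.
      have e : ((lo + hi + 1) / 2 - 1 : ℕ) + 1 = (lo + hi + 1) / 2 := by omega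
      split_ifs with h
      · refine (ih lo ((lo + hi + 1) / 2 - 1) (by omega) (by omega)).mono ?_
        rintro m n r nm' rm' ⟨rfl, rfl, h1, h2, h3, h4, h5⟩
        refine ⟨rfl, rfl, h1, by omega, h3, ?_, by omega⟩
        rcases h4 with rfl | h4
        exacts [.inr h, .inr h4]
      · refine (ih ((lo + hi + 1) / 2) hi (by omega) (by omega)).mono ?_
        rintro m n r nm' rm' ⟨rfl, rfl, h1, h2, h3, h4, h5⟩
        refine ⟨rfl, rfl, by omega, h2, ?_, h4, by omega⟩
        rcases h3 with rfl | h3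
        exacts [.inr (not_lt.1 h), .inr h3]
    · obtain rfl : lo = hi := by omega
      simp [bsearchBody]
      omega

/-- Half the length of the part of the line that lies in the disk of radius `v` around a point with
coordinate `p.1` and squared distance `p.2` from the line. -/
noncomputable def rad (v : ℝ) (p : ℝ × ℝ) : ℝ := √(v ^ 2 - p.2)

theorem rad_nonneg (v : ℝ) (p : ℝ × ℝ) : 0 ≤ rad v p := Real.sqrt_nonneg _

/-- The position `x` on the line is not in the open disk of radius `v` around `p`. -/
def Free (v : ℝ) (p : ℝ × ℝ) (x : ℝ) : Prop := x ≤ p.1 - rad v p ∨ p.1 + rad v p ≤ x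

/-- Positions of `k` centers, from right to left, at distance at least `σ` from each other, outside
of the disks around the points of `l`; those to the left of `M` are to the left of these disks. -/
structure RightToLeft (l : List (ℝ × ℝ)) (v σ L M : ℝ) (k : ℕ) (z : ℕ → ℝ) : Prop where
  le : ∀ j < k, z j ≤ L
  free : ∀ j < k, ∀ p ∈ l, Free v p (z j)
  left : ∀ j < k, z j < M → ∀ p ∈ l, z j ≤ p.1 - rad v p
  step : ∀ j, j + 1 < k → z (j + 1) ≤ z j - σ

/-- The greedy algorithm has placed all but `n` of `k` centers, from right to left and to the right
of `M`, and the next one cannot be to the right of `Y`. -/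
structure Greedy (l : List (ℝ × ℝ)) (v σ L M : ℝ) (k n : ℕ) (Y : ℝ) : Prop where
  le : n ≤ k
  exists_pos : ∃ z : ℕ → ℝ, (∀ j < k - n, M ≤ z j ∧ z j ≤ L ∧ Y + σ ≤ z j ∧ ∀ p ∈ l, Free v p (z j)) ∧
    ∀ j, j + 1 < k - n → z (j + 1) ≤ z j - σ
  le_right : Y ≤ L
  le_left : ∀ p ∈ l, Y ≤ p.1 - rad v p
  next_le : ∀ z, RightToLeft l v σ L M k z → 0 < n → z (k - n) ≤ Y

theorem RightToLeft.le_sub {l : List (ℝ × ℝ)} {v σ L M : ℝ} {k : ℕ} {z : ℕ → ℝ}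
    (h : RightToLeft l v σ L M k z) (i c : ℕ) (hi : i + c < k) : z (i + c) ≤ z i - c * σ := by
  induction c with
  | zero => simp
  | succ c ih =>
    have h1 := ih (by omega)
    have h2 := h.step (i + c) (by omega)
    push_cast
    rw [← add_assoc]
    linarith

theorem Greedy.nil (v σ L M : ℝ) (k : ℕ) : Greedy [] v σ L M k k L where
  le := le_rfl
  exists_pos := ⟨fun _ => 0, by simp⟩
  le_right := le_rfl
  le_left := by simp
  next_le z hz hk := hz.le _ (by omega)

/-- The new centers are `Y, Y - σ, …, Y - (c - 1) * σ`. They are to the left of all disks of `l`,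
and by `h1` not to the left of `M`. Any competing placement is no further right, so if `c < n`, its
next center is at most `Y - c * σ < M`. -/
theorem Greedy.fill {l : List (ℝ × ℝ)} {v σ L M : ℝ} {k n : ℕ} {Y : ℝ}
    (h : Greedy l v σ L M k n Y) (hσ : 0 ≤ σ) {c : ℕ} (hc : c ≤ n)
    (h1 : c = 0 ∨ M + (c - 1 : ℕ) * σ ≤ Y) (h2 : c = n ∨ Y < M + c * σ) :
    Greedy l v σ L M k (n - c) (Y - c * σ) ∧
      ∀ z, RightToLeft l v σ L M k z → 0 < n - c → z (k - (n - c)) < M := by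
  have hcσ : 0 ≤ c * σ := by positivity
  have hle := h.le
  have key : ∀ z, RightToLeft l v σ L M k z → 0 < n - c → z (k - (n - c)) ≤ Y - c * σ := by
    intro z hz hn
    have e1 := h.next_le z hz (by omega)
    have e2 := hz.le_sub (k - n) c (by omega)
    rw [show k - (n - c) = k - n + c by omega]
    linarith
  refine ⟨⟨by omega, ?_, by linarith [h.le_right], fun p hp => by linarith [h.le_left p hp], key⟩,
    fun z hz hn => ?_⟩
  · obtain ⟨z, hz1, hz2⟩ := h.exists_pos
    refine ⟨fun j => if j < k - n then z j else Y - (j - (k - n) : ℕ) * σ, fun j hj => ?_,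
      fun j hj => ?_⟩
    · dsimp only
      split_ifs with hjk
      · obtain ⟨a1, a2, a3, a4⟩ := hz1 j hjk
        exact ⟨a1, a2, by linarith, a4⟩
      · obtain ⟨i, rfl⟩ : ∃ i, j = k - n + i := ⟨j - (k - n), by omega⟩
        rw [Nat.add_sub_cancel_left]
        have hi : i + 1 ≤ c := by omega
        have hi' : (i : ℝ) + 1 ≤ c := by exact_mod_cast hi
        have hiσ : (i : ℝ) * σ + σ ≤ c * σ := by nlinarith
        have hi0 : 0 ≤ (i : ℝ) * σ := by positivity
        refine ⟨?_, by linarith [h.le_right], by linarith, fun p hp => .inl ?_⟩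
        · rcases h1 with rfl | h1
          · omega
          · rw [Nat.cast_sub (by omega)] at h1
            push_cast at h1
            linarith
        · linarith [h.le_left p hp]
    · dsimp only
      split_ifs with e1 e2 e2
      · exact hz2 j e1
      · omega
      · have e3 : j + 1 = k - n := by omega
        have := (hz1 j e2).2.2.1
        rw [show j + 1 - (k - n) = 0 by omega]
        simp
        linarith
      · rw [show j + 1 - (k - n) = j - (k - n) + 1 by omega]
        push_cast
        linarith
  · have := key z hz hn
    rcases h2 with rfl | h2
    · omega
    · linarith

/-- A free position left of the right end of the disk of `p` is left of the whole disk. It is then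
left of the disk of every later point as well, since `p.1 ≤ q.1`, even though the disk ends
themselves need not be sorted. Hence a placement for `p :: l` and `M` is one for `l` and the raised
bound `max M (p.1 + rad v p)`, and its next center also obeys the new bound `p.1 - rad v p`. -/
theorem Greedy.cons {p : ℝ × ℝ} {l : List (ℝ × ℝ)} {v σ L M : ℝ} {k n : ℕ} {Y : ℝ}
    (hp : ∀ q ∈ l, p.1 ≤ q.1) (h : Greedy l v σ L (max M (p.1 + rad v p)) k n Y)
    (hn : ∀ z, RightToLeft l v σ L (max M (p.1 + rad v p)) k z → 0 < n →
      z (k - n) < max M (p.1 + rad v p)) :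
    Greedy (p :: l) v σ L M k n (min Y (p.1 - rad v p)) where
  le := h.le
  exists_pos := by
    obtain ⟨z, hz1, hz2⟩ := h.exists_pos
    refine ⟨z, fun j hj => ?_, hz2⟩
    obtain ⟨a1, a2, a3, a4⟩ := hz1 j hj
    refine ⟨(le_max_left _ _).trans a1, a2, by linarith [min_le_left Y (p.1 - rad v p)], ?_⟩
    simp only [List.mem_cons, forall_eq_or_imp]
    exact ⟨.inr ((le_max_right _ _).trans a1), a4⟩
  le_right := (min_le_left _ _).trans h.le_right
  le_left := by
    simp only [List.mem_cons, forall_eq_or_imp]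
    exact ⟨min_le_right _ _, fun q hq => (min_le_left _ _).trans (h.le_left q hq)⟩
  next_le z hz hn0 := by
    have hk := h.le
    have hleft : ∀ j < k, z j < max M (p.1 + rad v p) → z j ≤ p.1 - rad v p := by
      intro j hj hlt
      rcases lt_max_iff.1 hlt with hlt | hlt
      · exact hz.left j hj hlt p List.mem_cons_self
      · exact (hz.free j hj p List.mem_cons_self).resolve_right (not_le.2 hlt)
    have hz' : RightToLeft l v σ L (max M (p.1 + rad v p)) k z :=
      { le := hz.le
        free := fun j hj q hq => hz.free j hj q (List.mem_cons_of_mem _ hq)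
        left := fun j hj hlt q hq => by
          have e1 := hleft j hj hlt
          have e2 := hp q hq
          have e3 := rad_nonneg v p
          have e4 := rad_nonneg v q
          rcases hz.free j hj q (List.mem_cons_of_mem _ hq) with e | e <;> linarith
        step := hz.step }
    exact le_min (h.next_le z hz' hn0) (hleft _ (by omega) (hn z hz' hn0))

/-- The pairs of real cells with the addresses `b, b + 1`, `b + 2, b + 3`, .... -/
def pairs (rm : ℕ → ℝ) : ℕ → ℕ → List (ℝ × ℝ)
  | _, 0 => []
  | b, len + 1 => (rm b, rm (b + 1)) :: pairs rm (b + 2) len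

@[simp] theorem pairs_zero (rm : ℕ → ℝ) (b : ℕ) : pairs rm b 0 = [] := rfl
theorem pairs_succ (rm : ℕ → ℝ) (b len : ℕ) :
    pairs rm b (len + 1) = (rm b, rm (b + 1)) :: pairs rm (b + 2) len := rfl

theorem pairs_congr {rm rm' : ℕ → ℝ} {b len : ℕ}
    (h : ∀ a, b ≤ a → a < b + 2 * len → rm' a = rm a) : pairs rm' b len = pairs rm b len := by
  induction len generalizing b with
  | zero => rfl
  | succ len ih =>
    rw [pairs_succ, pairs_succ, h b le_rfl (by omega), h (b + 1) (by omega) (by omega),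
      ih (fun a h1 h2 => h a (by omega) (by omega))]

/-- Procedure 5: the greedy placement from right to left. -/
def decBody : Cmd :=
  .cond (.ltN 0 (N 1))
    (.setR 4 (R 0 * R 0 - RM (N 0 + 1)).sqrt ++
      .call 4 5 5 [N 0 + 2, N 1 - 1, N 2] [R 0, R 1, (R 2).mx (RM (N 0) + R 4), R 3] ++
      .setR 5 ((R 5).mn (RM (N 0) - R 4)))
    (.setN 4 (N 2) ++ .setR 5 (R 3)) ++
  (.call 6 6 4 [0, N 4] [R 5, R 2, R 1] ++ .setN 0 (N 4 - N 6) ++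
    .setR 0 (R 5 - .ofNat (N 6) * R 1))

/-- Going down, the recursion accumulates the maximum of the right ends in `M`; coming back, it
accumulates the minimum of the left ends in the returned bound. Each point is followed by one binary
search with at most `s + 1` levels. -/
theorem call_dec (h4 : procs[4]? = some bsearchBody) (h5 : procs[5]? = some decBody) {σ : ℝ}
    (hσ : 0 ≤ σ) (v L : ℝ) (k s : ℕ) (hs : k < 2 ^ s) (nm : ℕ → ℕ) (rm : ℕ → ℝ) (len b : ℕ) (M : ℝ)
    (hsort : (pairs rm b len).Pairwise (fun x y => x.1 ≤ y.1)) :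
    Call procs 5 [b, len, k] [v, σ, M, L] nm rm (fun m n r nm' rm' => nm' = nm ∧ rm' = rm ∧
      Greedy (pairs rm b len) v σ L M k n r ∧
      (∀ z, RightToLeft (pairs rm b len) v σ L M k z → 0 < n → z (k - n) < M) ∧
      m ≤ 1000 * ((s + 1) * (len + 1))) := by
  induction len generalizing b M with
  | zero =>
    refine Call.intro h5 ?_
    simp [decBody]
    refine (call_bsearch h4 L M σ nm rm s 0 k (by omega) (by omega)).mono ?_
    rintro m n r nm' rm' ⟨rfl, rfl, -, h2, h3, h4, h5⟩
    simp
    have := (Greedy.nil v σ L M k).fill hσ h2 h3 h4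
    exact ⟨this.1, by simpa using this.2, by omega⟩
  | succ len ih =>
    refine Call.intro h5 ?_
    rw [pairs_succ, List.pairwise_cons] at hsort
    rw [pairs_succ]
    simp [decBody]
    refine (ih (b + 2) _ hsort.2).mono ?_
    rintro m n r nm' rm' ⟨rfl, rfl, hG, hlt, hm⟩
    have hn := hG.le
    have hG' := Greedy.cons (p := (rm' b, rm' (b + 1))) (M := M) hsort.1 (n := n) (Y := r)
      (by simpa [rad, sq] using hG) (by simpa [rad, sq] using hlt)
    refine (call_bsearch h4 _ M σ nm' rm' s 0 n (by omega) (by omega)).mono ?_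
    rintro m1 n1 r1 nm1 rm1 ⟨rfl, rfl, -, h2, h3, h4, h5⟩
    simp
    have := hG'.fill hσ h2 (by simpa [rad, sq] using h3) (by simpa [rad, sq] using h4)
    simp only [rad, sq] at this
    refine ⟨this.1, by simpa using this.2, ?_⟩
    have : (s + 1) * (len + 1 + 1) = (s + 1) * (len + 1) + (s + 1) := by ring
    omega

/-! ### The one-dimensional problem -/

theorem rad_mono {u v : ℝ} (hu : 0 ≤ u) (h : u ≤ v) (p : ℝ × ℝ) : rad u p ≤ rad v p :=
  Real.sqrt_le_sqrt (by nlinarith)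

theorem rad_eq_zero {v H : ℝ} (hv : 0 ≤ v) (h : v ≤ H) (a : ℝ) : rad v (a, H ^ 2) = 0 :=
  Real.sqrt_eq_zero_of_nonpos (by simp only; nlinarith)

/-- There are `k` positions in `[0, L]`, in increasing order, outside of the open disks of radius
`v` around the points of `pts` and at distance at least `v / α` from each other. -/
def Feas (pts : List (ℝ × ℝ)) (L α : ℝ) (k : ℕ) (v : ℝ) : Prop :=
  ∃ x : ℕ → ℝ, (∀ j < k, 0 ≤ x j ∧ x j ≤ L ∧ ∀ p ∈ pts, Free v p (x j)) ∧
    ∀ j, j + 1 < k → v ≤ α * (x (j + 1) - x j)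

theorem Feas.anti {pts : List (ℝ × ℝ)} {L α : ℝ} {k : ℕ} {u v : ℝ} (hu : 0 ≤ u) (huv : u ≤ v)
    (h : Feas pts L α k v) : Feas pts L α k u := by
  obtain ⟨x, h1, h2⟩ := h
  refine ⟨x, fun j hj => ⟨(h1 j hj).1, (h1 j hj).2.1, fun p hp => ?_⟩,
    fun j hj => huv.trans (h2 j hj)⟩
  have := rad_mono hu huv p
  rcases (h1 j hj).2.2 p hp with e | e
  exacts [.inl (by linarith), .inr (by linarith)]

/-- For `M = 0` the condition `left` is vacuous for positions in `[0, L]`. If centers remain, every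
placement would have a center at a negative position. The index `k - 1 - j` reverses the order. -/
theorem Greedy.eq_zero_iff_feas {pts : List (ℝ × ℝ)} {v L α Y : ℝ} {k n : ℕ} (hα : 0 < α)
    (h : Greedy pts v (v / α) L 0 k n Y)
    (hn : ∀ z, RightToLeft pts v (v / α) L 0 k z → 0 < n → z (k - n) < 0) :
    n = 0 ↔ Feas pts L α k v := by
  constructor
  · rintro rfl
    obtain ⟨z, h1, h2⟩ := h.exists_pos
    rw [Nat.sub_zero] at h1 h2
    refine ⟨fun j => z (k - 1 - j), fun j hj => ?_, fun j hj => ?_⟩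
    · obtain ⟨a1, a2, -, a4⟩ := h1 (k - 1 - j) (by omega)
      exact ⟨a1, a2, a4⟩
    · have := h2 (k - 1 - (j + 1)) (by omega)
      rw [show k - 1 - (j + 1) + 1 = k - 1 - j by omega] at this
      rw [mul_comm, ← div_le_iff₀ hα]
      linarith
  · rintro ⟨x, h1, h2⟩
    by_contra hn0
    have hle := h.le
    have hz : RightToLeft pts v (v / α) L 0 k (fun j => x (k - 1 - j)) :=
      { le := fun j hj => (h1 (k - 1 - j) (by omega)).2.1
        free := fun j hj => (h1 (k - 1 - j) (by omega)).2.2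
        left := fun j hj hlt => absurd (h1 (k - 1 - j) (by omega)).1 (not_le.2 hlt)
        step := fun j hj => by
          have := h2 (k - 1 - (j + 1)) (by omega)
          rw [show k - 1 - (j + 1) + 1 = k - 1 - j by omega, mul_comm, ← div_le_iff₀ hα] at this
          linarith }
    exact absurd (h1 (k - 1 - (k - n)) (by omega)).1 (not_le.2 (hn _ hz (by omega)))

/-! ### Critical radii -/

/-- The free space needed between a disk of radius `v` and another one, when they are `μ v` apart. -/
noncomputable def need (w₁ w₂ μ v : ℝ) : ℝ := √(v ^ 2 - w₁) + √(v ^ 2 - w₂) + μ * v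

theorem need_nonneg {w₁ w₂ μ v : ℝ} (hμ : 0 ≤ μ) (hv : 0 ≤ v) : 0 ≤ need w₁ w₂ μ v := by
  unfold need; positivity

theorem need_mono {w₁ w₂ μ u v : ℝ} (hμ : 0 ≤ μ) (hu : 0 ≤ u) (h : u ≤ v) :
    need w₁ w₂ μ u ≤ need w₁ w₂ μ v := by
  unfold need
  have : u ^ 2 ≤ v ^ 2 := by nlinarith
  gcongr

theorem continuous_need (w₁ w₂ μ : ℝ) : Continuous (need w₁ w₂ μ) := by
  unfold need; fun_prop

/-- `c` is the largest radius for which the distance `d` suffices. -/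
def IsThreshold (w₁ w₂ μ d c : ℝ) : Prop := ∀ v, 0 ≤ v → (need w₁ w₂ μ v ≤ d ↔ v ≤ c)

/-- If none of the critical radii is strictly between `lo` and an infeasible radius `hi`, then no
radius between them is feasible. -/
theorem not_feas_of_thresholds {pts : List (ℝ × ℝ)} {L α H lo hi v : ℝ} {k : ℕ} (hα : 0 < α)
    (hlo : 0 ≤ lo) (hH : hi ≤ H) (hhi : ¬ Feas pts L α k hi)
    (hc : ∀ p ∈ pts ++ [(0, H ^ 2), (L, H ^ 2)], ∀ q ∈ pts ++ [(0, H ^ 2), (L, H ^ 2)], ∀ m < k,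
      ∃ c, IsThreshold p.2 q.2 (m / α) (q.1 - p.1) c ∧ (c ≤ lo ∨ hi ≤ c))
    (hv : lo < v) (hvhi : v < hi) : ¬ Feas pts L α k v := by
  rintro ⟨x, h1, h2⟩
  apply hhi
  classical
  set A := pts ++ [(0, H ^ 2), (L, H ^ 2)] with hA
  have hA0 : (0, H ^ 2) ∈ A := by simp [hA]
  have hAL : (L, H ^ 2) ∈ A := by simp [hA]
  have hAp : ∀ p ∈ pts, p ∈ A := fun p hp => by simp [hA, hp]
  have hx : ∀ i m, i + m < k → x i + m * (v / α) ≤ x (i + m) := by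
    intro i m
    induction m with
    | zero => simp
    | succ m ih =>
      intro him
      have e1 := ih (by omega)
      have e2 := h2 (i + m) (by omega)
      rw [mul_comm, ← div_le_iff₀ hα] at e2
      push_cast
      rw [← add_assoc]
      linarith
  -- The positions `x` show that the critical radius `c` of this chain is at least `v > lo`. As it
  -- is not strictly between `lo` and `hi`, it is at least `hi`, so the chain still fits at radius
  -- `hi`.
  have key : ∀ i m, i + m < k → ∀ p ∈ A, p.1 + rad v p ≤ x i → ∀ q ∈ A,
      x (i + m) ≤ q.1 - rad v q → p.1 + rad hi p + m * (hi / α) ≤ q.1 - rad hi q := by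
    intro i m him p hp hpi q hq hqj
    obtain ⟨c, hc1, hc2⟩ := hc p hp q hq m (by omega)
    have e := hx i m him
    have e1 : v ≤ c := by
      refine (hc1 v (by linarith)).1 ?_
      have : (m : ℝ) / α * v = m * (v / α) := by ring
      unfold need
      unfold rad at hpi hqj
      linarith
    have e2 := (hc1 hi (by linarith)).2 (by rcases hc2 with h | h <;> linarith)
    have : (m : ℝ) / α * hi = m * (hi / α) := by ring
    unfold need at e2
    unfold rad
    linarith
  -- Among the disks to the left of `x j` at radius `v`, take one that reaches furthest at radius
  -- `hi`; the left end of the segment always qualifies.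
  have hg : ∀ j, ∃ p, j < k → p ∈ A ∧ p.1 + rad v p ≤ x j ∧
      ∀ q ∈ A, q.1 + rad v q ≤ x j → q.1 + rad hi q ≤ p.1 + rad hi p := by
    intro j
    by_cases hj : j < k
    · obtain ⟨p, hp, hmax⟩ := Finset.exists_max_image
        (A.toFinset.filter (fun p => p.1 + rad v p ≤ x j)) (fun p => p.1 + rad hi p)
        ⟨(0, H ^ 2), by
          simp only [Finset.mem_filter, List.mem_toFinset]
          refine ⟨hA0, ?_⟩
          rw [rad_eq_zero (by linarith) (by linarith)]
          simpa using (h1 j hj).1⟩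
      simp only [Finset.mem_filter, List.mem_toFinset] at hp hmax
      exact ⟨p, fun _ => ⟨hp.1, hp.2, fun q hq hqx => hmax q ⟨hq, hqx⟩⟩⟩
    · exact ⟨0, fun h => absurd h hj⟩
  choose g hg using hg
  -- The new positions are the leftmost ones at radius `hi` that keep every center on the same side
  -- of each disk as before. By `hX`, each of them ends a tight chain that starts at some disk,
  -- which is the situation of `key`.
  let X : ℕ → ℝ := fun j => Nat.rec ((g 0).1 + rad hi (g 0))
    (fun j y => max (y + hi / α) ((g (j + 1)).1 + rad hi (g (j + 1)))) j
  have hXs : ∀ j, X (j + 1) = max (X j + hi / α) ((g (j + 1)).1 + rad hi (g (j + 1))) :=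
    fun j => rfl
  have hXg : ∀ j, (g j).1 + rad hi (g j) ≤ X j := by
    rintro (_ | j)
    exacts [le_rfl, (hXs j).symm ▸ le_max_right _ _]
  have hX : ∀ j, ∃ i m : ℕ, i + m = j ∧ X j = (g i).1 + rad hi (g i) + m * (hi / α) := by
    intro j
    induction j with
    | zero => exact ⟨0, 0, rfl, by simp [X]⟩
    | succ j ih =>
      rcases max_choice (X j + hi / α) ((g (j + 1)).1 + rad hi (g (j + 1))) with h | h
      · obtain ⟨i, m, him, e⟩ := ih
        refine ⟨i, m + 1, by omega, ?_⟩
        rw [hXs, h, e]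
        push_cast
        ring
      · exact ⟨j + 1, 0, rfl, by rw [hXs, h]; simp⟩
  have hup : ∀ j < k, ∀ q ∈ A, x j ≤ q.1 - rad v q → X j ≤ q.1 - rad hi q := by
    intro j hj q hq hxq
    obtain ⟨i, m, rfl, e⟩ := hX j
    obtain ⟨a1, a2, -⟩ := hg i (by omega)
    rw [e]
    exact key i m hj _ a1 a2 q hq hxq
  refine ⟨X, fun j hj => ⟨?_, ?_, fun p hp => ?_⟩, fun j hj => ?_⟩
  · have := (hg j hj).2.2 _ hA0 (by
      rw [rad_eq_zero (by linarith) (by linarith)]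
      simpa using (h1 j hj).1)
    have h3 := rad_nonneg hi ((0 : ℝ), H ^ 2)
    simp only at this
    linarith [hXg j]
  · have := hup j hj _ hAL (by
      rw [rad_eq_zero (by linarith) (by linarith)]
      simpa using (h1 j hj).2.1)
    have h3 := rad_nonneg hi (L, H ^ 2)
    simp only at this
    linarith
  · rcases (h1 j hj).2.2 p hp with h | h
    · exact .inl (hup j hj p (hAp p hp) h)
    · exact .inr (((hg j hj).2.2 p (hAp p hp) h).trans (hXg j))
  · have : X j + hi / α ≤ X (j + 1) := (hXs j).symm ▸ le_max_left _ _
    rw [mul_comm, ← div_le_iff₀ hα]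
    linarith

/-! ### Computing a critical radius -/

/-- A nonzero constant coefficient excludes the zero polynomial even when leading coefficients
vanish, so the degree need not be known. -/
theorem exists_quarticRoot_eq {a₀ a₁ a₂ a₃ a₄ u : ℝ} (h0 : a₀ ≠ 0)
    (hu : a₀ + a₁ * u + a₂ * u ^ 2 + a₃ * u ^ 3 + a₄ * u ^ 4 = 0) :
    ∃ j < 4, quarticRoot j a₀ a₁ a₂ a₃ a₄ = u := by
  set p : Polynomial ℝ := Polynomial.C a₀ + Polynomial.C a₁ * Polynomial.X +
    Polynomial.C a₂ * Polynomial.X ^ 2 + Polynomial.C a₃ * Polynomial.X ^ 3 +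
    Polynomial.C a₄ * Polynomial.X ^ 4 with hp
  have hp0 : p ≠ 0 := by
    intro h
    have : p.eval 0 = a₀ := by simp [hp]
    rw [h] at this
    simp at this
    exact h0 this.symm
  have hdeg : p.natDegree ≤ 4 := by rw [hp]; compute_degree
  have hmem : u ∈ p.roots.toFinset.sort (· ≤ ·) := by
    rw [Finset.mem_sort, Multiset.mem_toFinset, Polynomial.mem_roots hp0, Polynomial.IsRoot.def]
    simp [hp]
    linarith
  obtain ⟨j, hj, hju⟩ := List.mem_iff_getElem.1 hmem
  have hlen : (p.roots.toFinset.sort (· ≤ ·)).length ≤ 4 := by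
    rw [Finset.length_sort]
    exact (Multiset.toFinset_card_le _).trans ((Polynomial.card_roots' p).trans hdeg)
  refine ⟨j, hj.trans_le hlen, ?_⟩
  unfold quarticRoot
  rw [← hp, List.getD_eq_getElem _ _ hj, hju]

theorem exists_need_eq {w₁ w₂ μ d v : ℝ} (hw₁ : 0 ≤ w₁) (hμ : 0 ≤ μ) (hv : 0 ≤ v) (hd : 0 < d)
    (h : need w₁ w₂ μ v ≤ d) : ∃ u, v ≤ u ∧ need w₁ w₂ μ u = d := by
  -- At `U` the first square root alone is at least `d`, which sets up the intermediate value
  -- theorem.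
  set U := max v √(d ^ 2 + w₁) with hU
  have hU0 : 0 ≤ U := hv.trans (le_max_left _ _)
  have h1 : d ≤ need w₁ w₂ μ U := by
    have e : d ^ 2 + w₁ ≤ U ^ 2 := by
      have : √(d ^ 2 + w₁) ^ 2 = d ^ 2 + w₁ := Real.sq_sqrt (by positivity)
      have h2 : √(d ^ 2 + w₁) ≤ U := le_max_right _ _
      have h3 := Real.sqrt_nonneg (d ^ 2 + w₁)
      nlinarith
    have : d ≤ √(U ^ 2 - w₁) := Real.le_sqrt_of_sq_le (by linarith)
    unfold need
    have := Real.sqrt_nonneg (U ^ 2 - w₂)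
    have := mul_nonneg hμ hU0
    linarith
  obtain ⟨u, hu, hu2⟩ := intermediate_value_Icc (le_max_left v √(d ^ 2 + w₁))
    (continuous_need w₁ w₂ μ).continuousOn ⟨h, h1⟩
  exact ⟨u, hu.1, hu2⟩

/-- A radius at which one of the disks meets the line and `need` has a given value is a root of a
quadratic polynomial. -/
theorem exists_quadratic_root {w μ d u : ℝ} (hw : 0 ≤ w) (hd : 0 < d) (hu : 0 ≤ u ^ 2 - w)
    (h : √(u ^ 2 - w) + μ * u = d) :
    ∃ j < 4, quarticRoot j (d * d + w) (0 - 2 * d * μ) (μ * μ - 1) 0 0 = u := by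
  refine exists_quarticRoot_eq (by positivity) ?_
  have := Real.sq_sqrt hu
  rw [show √(u ^ 2 - w) = d - μ * u by linarith] at this
  linarith

/-- A radius at which both disks meet the line and `need` has a given value is a root of a
quartic polynomial. -/
theorem exists_quartic_root {w₁ w₂ μ d u : ℝ} (hw₁ : 0 ≤ w₁) (hw₂ : 0 ≤ w₂) (hd : 0 < d)
    (h₁ : 0 ≤ u ^ 2 - w₁) (h₂ : 0 ≤ u ^ 2 - w₂) (h : need w₁ w₂ μ u = d) :
    ∃ j < 4, quarticRoot j
      ((d * d + w₁ + w₂) * (d * d + w₁ + w₂) - 4 * w₁ * w₂)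
      (0 - 4 * d * μ * (d * d + w₁ + w₂))
      (4 * d * d * μ * μ + 2 * (μ * μ - 2) * (d * d + w₁ + w₂) + 4 * (w₁ + w₂))
      (0 - 4 * d * μ * (μ * μ - 2))
      ((μ * μ - 2) * (μ * μ - 2) - 4) = u := by
  refine exists_quarticRoot_eq ?_ ?_
  -- The constant coefficient equals `d⁴ + 2 d² (w₁ + w₂) + (w₁ - w₂)²`.
  · have : 0 < (d * d + w₁ + w₂) * (d * d + w₁ + w₂) - 4 * w₁ * w₂ := by
      have e1 : 0 < d * d := by positivity
      have e2 : 0 ≤ d * d * (w₁ + w₂) := by positivity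
      nlinarith [sq_nonneg (w₁ - w₂)]
    exact this.ne'
  · have e₁ := Real.sq_sqrt h₁
    have e₂ := Real.sq_sqrt h₂
    set a := √(u ^ 2 - w₁)
    set b := √(u ^ 2 - w₂)
    have hab : a + b = d - μ * u := by unfold need at h; linarith
    -- Squaring `a + b = d - μ u` isolates `a b`; a second squaring removes both roots.
    have e3 : 2 * (a * b) = (d - μ * u) ^ 2 - (2 * u ^ 2 - w₁ - w₂) := by
      rw [← hab]; linarith
    have e4 : ((d - μ * u) ^ 2 - (2 * u ^ 2 - w₁ - w₂)) ^ 2 =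
        4 * ((u ^ 2 - w₁) * (u ^ 2 - w₂)) := by
      rw [← e3, ← e₁, ← e₂]; ring
    linarith

/-- The numbers among which the threshold is found, as expressions in the real variables `1, 2, 3, 4`
that hold `w₁, w₂, μ, d`. -/
def tentative : List RExpr :=
  [0, (R 1).sqrt, (R 2).sqrt, R 4 / R 3] ++
  (List.range 4).map (fun j => .root j (R 4 * R 4 + R 1) (0 - 2 * R 4 * R 3) (R 3 * R 3 - 1) 0 0) ++
  (List.range 4).map (fun j => .root j (R 4 * R 4 + R 2) (0 - 2 * R 4 * R 3) (R 3 * R 3 - 1) 0 0) ++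
  (List.range 4).map (fun j => .root j
    ((R 4 * R 4 + R 1 + R 2) * (R 4 * R 4 + R 1 + R 2) - 4 * R 1 * R 2)
    (0 - 4 * R 4 * R 3 * (R 4 * R 4 + R 1 + R 2))
    (4 * R 4 * R 4 * R 3 * R 3 + 2 * (R 3 * R 3 - 2) * (R 4 * R 4 + R 1 + R 2) + 4 * (R 1 + R 2))
    (0 - 4 * R 4 * R 3 * (R 3 * R 3 - 2))
    ((R 3 * R 3 - 2) * (R 3 * R 3 - 2) - 4))

/-- For `d > 0`, `need` takes the value `d` at some `u ≥ v`. According to which of the two disks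
meet the line at radius `u`, this `u` is a root of the quartic, a root of one of the quadratics, or
`d / μ`. -/
theorem exists_tentative (s : State) (hw₁ : 0 ≤ s.rvar 1) (hw₂ : 0 ≤ s.rvar 2)
    (hμ : 0 ≤ s.rvar 3) {v : ℝ} (hv : 0 ≤ v)
    (h : need (s.rvar 1) (s.rvar 2) (s.rvar 3) v ≤ s.rvar 4) :
    ∃ e ∈ tentative, v ≤ e.eval s ∧
      need (s.rvar 1) (s.rvar 2) (s.rvar 3) (e.eval s) ≤ s.rvar 4 := by
  have hd : 0 ≤ s.rvar 4 := (need_nonneg hμ hv).trans h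
  -- For `d = 0` constant coefficients can vanish. The threshold is then `0`, or the smaller of
  -- `√w₁` and `√w₂` if `μ = 0`.
  rcases hd.eq_or_lt with hd | hd
  · rw [← hd] at h ⊢
    have p1 := Real.sqrt_nonneg (v ^ 2 - s.rvar 1)
    have p2 := Real.sqrt_nonneg (v ^ 2 - s.rvar 2)
    have p3 := mul_nonneg hμ hv
    unfold need at h
    rcases hμ.eq_or_lt with hμ | hμ
    · have q1 : v ^ 2 ≤ s.rvar 1 := by
        have := Real.sqrt_eq_zero'.1 (le_antisymm (by linarith) p1); linarith
      have q2 : v ^ 2 ≤ s.rvar 2 := by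
        have := Real.sqrt_eq_zero'.1 (le_antisymm (by linarith) p2); linarith
      rcases le_total (s.rvar 1) (s.rvar 2) with hle | hle
      · refine ⟨(R 1).sqrt, by simp [tentative], Real.le_sqrt_of_sq_le q1, ?_⟩
        simp only [need, RExpr.eval_sqrt, eval_R, Real.sq_sqrt hw₁, ← hμ]
        rw [Real.sqrt_eq_zero_of_nonpos (by linarith : s.rvar 1 - s.rvar 1 ≤ 0),
          Real.sqrt_eq_zero_of_nonpos (by linarith)]
        simp
      · refine ⟨(R 2).sqrt, by simp [tentative], Real.le_sqrt_of_sq_le q2, ?_⟩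
        simp only [need, RExpr.eval_sqrt, eval_R, Real.sq_sqrt hw₂, ← hμ]
        rw [Real.sqrt_eq_zero_of_nonpos (by linarith : s.rvar 2 - s.rvar 2 ≤ 0),
          Real.sqrt_eq_zero_of_nonpos (by linarith)]
        simp
    · have : v ≤ 0 := by
        by_contra hcon
        have := mul_pos hμ (not_le.1 hcon)
        linarith
      refine ⟨0, by simp [tentative], by simpa using this, ?_⟩
      simp [need, Real.sqrt_eq_zero_of_nonpos, hw₁, hw₂]
  · obtain ⟨u, hvu, hu⟩ := exists_need_eq hw₁ hμ hv hd h
    suffices hs : ∃ e ∈ tentative, e.eval s = u by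
      obtain ⟨e, he, rfl⟩ := hs
      exact ⟨e, he, hvu, hu.le⟩
    rcases le_total (s.rvar 1) (u ^ 2) with h1 | h1 <;>
    rcases le_total (s.rvar 2) (u ^ 2) with h2 | h2
    · obtain ⟨j, hj, e⟩ := exists_quartic_root hw₁ hw₂ hd (by linarith) (by linarith) hu
      refine ⟨_, List.mem_append_right _ (List.mem_map.2 ⟨j, List.mem_range.2 hj, rfl⟩), ?_⟩
      simpa using e
    · have : √(u ^ 2 - s.rvar 2) = 0 := Real.sqrt_eq_zero_of_nonpos (by linarith)
      obtain ⟨j, hj, e⟩ := exists_quadratic_root hw₁ hd (μ := s.rvar 3) (u := u) (by linarith)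
        (by rw [← hu, need, this]; ring)
      refine ⟨_, List.mem_append_left _ (List.mem_append_left _ (List.mem_append_right _
        (List.mem_map.2 ⟨j, List.mem_range.2 hj, rfl⟩))), ?_⟩
      simpa using e
    · have : √(u ^ 2 - s.rvar 1) = 0 := Real.sqrt_eq_zero_of_nonpos (by linarith)
      obtain ⟨j, hj, e⟩ := exists_quadratic_root hw₂ hd (μ := s.rvar 3) (u := u) (by linarith)
        (by rw [← hu, need, this]; ring)
      refine ⟨_, List.mem_append_left _ (List.mem_append_right _
        (List.mem_map.2 ⟨j, List.mem_range.2 hj, rfl⟩)), ?_⟩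
      simpa using e
    · refine ⟨R 4 / R 3, by simp [tentative], ?_⟩
      rw [need, Real.sqrt_eq_zero_of_nonpos (by linarith : u ^ 2 - s.rvar 1 ≤ 0),
        Real.sqrt_eq_zero_of_nonpos (by linarith)] at hu
      have : s.rvar 3 ≠ 0 := by
        rintro h0
        rw [h0] at hu
        linarith
      simp only [RExpr.eval_div', eval_R]
      rw [← hu]
      field_simp
      ring

/-- Records the value of an expression in the real variable `5` if it is larger than what is there
and the free space suffices for it. -/
def tryCmd (e : RExpr) : Cmd :=
  .setR 6 e ++
    .cond (.and (.not (.ltR (R 6) 0)) (.and (.not (.ltR (R 4)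
      ((R 6 * R 6 - R 1).sqrt + (R 6 * R 6 - R 2).sqrt + R 3 * R 6))) (.ltR (R 5) (R 6))))
      (.setR 5 (R 6)) .skip

def tryAll : List RExpr → Cmd
  | [] => .skip
  | e :: l => tryCmd e ++ tryAll l

def tryCost (l : List RExpr) : ℕ := (l.map (fun e => e.cost + 100)).sum + 1

theorem wp_tryAll (s : State) (l : List RExpr)
    (hl : ∀ e ∈ l, ∀ t : State, (∀ i, 1 ≤ i → i ≤ 4 → t.rvar i = s.rvar i) → e.eval t = e.eval s)
    (t : State) (ht : ∀ i, 1 ≤ i → i ≤ 4 → t.rvar i = s.rvar i) (hm : t.nmem = s.nmem)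
    (hr : t.rmem = s.rmem)
    (h5 : t.rvar 5 = -1 ∨ 0 ≤ t.rvar 5 ∧
      need (s.rvar 1) (s.rvar 2) (s.rvar 3) (t.rvar 5) ≤ s.rvar 4) :
    Wp procs (tryAll l) t (fun m t' => t'.nmem = s.nmem ∧ t'.rmem = s.rmem ∧
      (t'.rvar 5 = -1 ∨ 0 ≤ t'.rvar 5 ∧
        need (s.rvar 1) (s.rvar 2) (s.rvar 3) (t'.rvar 5) ≤ s.rvar 4) ∧
      t.rvar 5 ≤ t'.rvar 5 ∧
      (∀ e ∈ l, 0 ≤ e.eval s → need (s.rvar 1) (s.rvar 2) (s.rvar 3) (e.eval s) ≤ s.rvar 4 →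
        e.eval s ≤ t'.rvar 5) ∧ m ≤ tryCost l) := by
  induction l generalizing t with
  | nil => simpa [tryAll, hm, hr, tryCost] using h5
  | cons e l ih =>
    have hle : ∀ e ∈ l, ∀ t : State, (∀ i, 1 ≤ i → i ≤ 4 → t.rvar i = s.rvar i) →
      e.eval t = e.eval s := fun e' he' => hl e' (List.mem_cons_of_mem _ he')
    have he := hl e List.mem_cons_self t ht
    have e1 := ht 1 (by omega) (by omega)
    have e2 := ht 2 (by omega) (by omega)
    have e3 := ht 3 (by omega) (by omega)
    have e4 := ht 4 (by omega) (by omega)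
    simp only [tryAll, tryCmd, wp_seq, wp_setR, wp_cond, wp_skip]
    split_ifs with hb
    · simp [he, e1, e2, e3, e4] at hb
      refine (ih hle _ (fun i h1 h4 => ?_) (by exact hm) (by exact hr) ?_).mono ?_
      · rw [← ht i h1 h4]
        simp [Function.update_of_ne (show i ≠ 5 by omega), Function.update_of_ne (show i ≠ 6 by omega)]
      · right
        simpa [he, need, sq] using ⟨hb.1, hb.2.1⟩
      · rintro m t' ⟨a1, a2, a3, a4, a5, a6⟩
        simp [he] at a4
        refine ⟨a1, a2, a3, hb.2.2.le.trans a4, ?_, ?_⟩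
        · simp only [List.mem_cons, forall_eq_or_imp]
          exact ⟨fun _ _ => a4, a5⟩
        · simp [tryCost] at a6 ⊢
          omega
    · simp [he, e1, e2, e3, e4] at hb
      refine (ih hle _ (fun i h1 h4 => ?_) (by exact hm) (by exact hr) ?_).mono ?_
      · rw [← ht i h1 h4]
        simp [Function.update_of_ne (show i ≠ 6 by omega)]
      · simpa using h5
      · rintro m t' ⟨a1, a2, a3, a4, a5, a6⟩
        simp at a4
        refine ⟨a1, a2, a3, a4, ?_, ?_⟩
        · simp only [List.mem_cons, forall_eq_or_imp]
          refine ⟨fun h1 h2 => (hb h1 ?_).trans a4, a5⟩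
          simpa [need, sq] using h2
        · simp [tryCost] at a6 ⊢
          omega

/-- The largest admissible tentative value is the threshold, by monotonicity of `need`. Spurious
roots are harmless because each value is tested. If none is admissible, the initial `-1` remains and
is a correct threshold. -/
theorem wp_tryTentative (s : State) (hw₁ : 0 ≤ s.rvar 1) (hw₂ : 0 ≤ s.rvar 2) (hμ : 0 ≤ s.rvar 3)
    (h5 : s.rvar 5 = -1) :
    Wp procs (tryAll tentative) s (fun m t => t.nmem = s.nmem ∧ t.rmem = s.rmem ∧
      IsThreshold (s.rvar 1) (s.rvar 2) (s.rvar 3) (s.rvar 4) (t.rvar 5) ∧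
      m ≤ tryCost tentative) := by
  refine (wp_tryAll s tentative ?_ s (fun _ _ _ => rfl) rfl rfl (.inl h5)).mono ?_
  · intro e he t ht
    have e1 := ht 1 (by omega) (by omega)
    have e2 := ht 2 (by omega) (by omega)
    have e3 := ht 3 (by omega) (by omega)
    have e4 := ht 4 (by omega) (by omega)
    simp only [tentative, List.mem_append, List.mem_cons, List.mem_map, List.not_mem_nil,
      or_false] at he
    rcases he with ((((rfl | rfl | rfl | rfl) | ⟨j, -, rfl⟩) | ⟨j, -, rfl⟩) | ⟨j, -, rfl⟩) <;>
      simp [e1, e2, e3, e4]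
  · rintro m t ⟨h1, h2, h3, -, h4, h5⟩
    refine ⟨h1, h2, fun v hv => ⟨fun h => ?_, fun h => ?_⟩, h5⟩
    · obtain ⟨e, he, hve, hne⟩ := exists_tentative s hw₁ hw₂ hμ hv h
      exact hve.trans (h4 e he (hv.trans hve) hne)
    · rcases h3 with h3 | ⟨-, h3⟩
      · linarith
      · exact (need_mono hμ hv h).trans h3

/-- Procedure 6: the critical radius for two points given by their addresses, with `m` centers
between them. -/
def candBody : Cmd :=
  .setR 1 (RM (N 0 + 1)) ++ .setR 2 (RM (N 1 + 1)) ++ .setR 3 (.ofNat (N 2) / R 0) ++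
    .setR 4 (RM (N 1) - RM (N 0)) ++ .setR 5 (0 - 1) ++ tryAll tentative ++ .setR 0 (R 5)

theorem call_cand (h6 : procs[6]? = some candBody) (i j m : ℕ) (α : ℝ) (hα : 0 < α)
    (nm : ℕ → ℕ) (rm : ℕ → ℝ) (hi : 0 ≤ rm (i + 1)) (hj : 0 ≤ rm (j + 1)) :
    Call procs 6 [i, j, m] [α] nm rm (fun t _ r nm' rm' => nm' = nm ∧ rm' = rm ∧
      IsThreshold (rm (i + 1)) (rm (j + 1)) (m / α) (rm j - rm i) r ∧
      t ≤ tryCost tentative + 100) := by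
  refine Call.intro h6 ?_
  simp [candBody]
  refine (wp_tryTentative _ (by simpa using hi) (by simpa using hj) (by simp; positivity)
    (by simp)).mono ?_
  rintro t s ⟨h1, h2, h3, h4⟩
  simp at h1 h2 h3
  exact ⟨h1, h2, h3, by omega⟩

/-! ### Rows of candidates -/

/-- The critical radius `c` for the points with the addresses `i` and `j`, with `m` centers between
them. -/
def IsCritical (rm : ℕ → ℝ) (α : ℝ) (i j m : ℕ) (c : ℝ) : Prop :=
  IsThreshold (rm (i + 1)) (rm (j + 1)) (m / α) (rm j - rm i) c

/-- More centers need more room, so critical radii decrease along a row. A negative threshold is not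
unique, hence the condition on `c'`. -/
theorem IsCritical.le_of_le {rm : ℕ → ℝ} {α : ℝ} (hα : 0 < α) {i j m m' : ℕ} {c c' : ℝ}
    (h : IsCritical rm α i j m c) (h' : IsCritical rm α i j m' c') (hm : m ≤ m') (hc : 0 ≤ c') :
    c' ≤ c := by
  refine (h c' hc).1 (le_trans ?_ ((h' c' hc).2 le_rfl))
  unfold need
  have : (m : ℝ) ≤ m' := by exact_mod_cast hm
  gcongr

/-- The existence is read off from a run of the command that computes the threshold. -/
theorem exists_isCritical (rm : ℕ → ℝ) {α : ℝ} (hα : 0 < α) (i j m : ℕ) (hi : 0 ≤ rm (i + 1))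
    (hj : 0 ≤ rm (j + 1)) : ∃ c, IsCritical rm α i j m c := by
  obtain ⟨-, t, -, -, -, h, -⟩ := wp_tryTentative (procs := [])
    ⟨fun _ => 0, env [0, rm (i + 1), rm (j + 1), m / α, rm j - rm i, -1] , fun _ => 0, rm⟩
    (by simpa using hi) (by simpa using hj) (by simp; positivity) rfl
  exact ⟨_, h⟩

/-- A row `(i, j, l, h)` stands for the candidates for the points with the addresses `i` and `j` with
at least `l` and less than `h` centers between them.  This reads the rows stored from `b` on. -/
def rows (nm : ℕ → ℕ) : ℕ → ℕ → List (ℕ × ℕ × ℕ × ℕ)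
  | _, 0 => []
  | b, len + 1 => (nm b, nm (b + 1), nm (b + 2), nm (b + 3)) :: rows nm (b + 4) len

@[simp] theorem rows_zero (nm : ℕ → ℕ) (b : ℕ) : rows nm b 0 = [] := rfl
theorem rows_succ (nm : ℕ → ℕ) (b len : ℕ) : rows nm b (len + 1) =
    (nm b, nm (b + 1), nm (b + 2), nm (b + 3)) :: rows nm (b + 4) len := rfl

theorem rows_congr {nm nm' : ℕ → ℕ} {b len : ℕ}
    (h : ∀ a, b ≤ a → a < b + 4 * len → nm' a = nm a) : rows nm' b len = rows nm b len := by
  induction len generalizing b with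
  | zero => rfl
  | succ len ih =>
    rw [rows_succ, rows_succ, h b le_rfl (by omega), h (b + 1) (by omega) (by omega),
      h (b + 2) (by omega) (by omega), h (b + 3) (by omega) (by omega),
      ih (fun a h1 h2 => h a (by omega) (by omega))]

@[simp] theorem length_rows (nm : ℕ → ℕ) (b len : ℕ) : (rows nm b len).length = len := by
  induction len generalizing b with
  | zero => rfl
  | succ len ih => simp [rows_succ, ih]

/-- The number of candidates in a list of rows. -/
def rowSum (l : List (ℕ × ℕ × ℕ × ℕ)) : ℕ := (l.map (fun r => r.2.2.2 - r.2.2.1)).sum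

@[simp] theorem rowSum_nil : rowSum [] = 0 := rfl
@[simp] theorem rowSum_cons (r : ℕ × ℕ × ℕ × ℕ) (l : List (ℕ × ℕ × ℕ × ℕ)) :
    rowSum (r :: l) = (r.2.2.2 - r.2.2.1) + rowSum l := by simp [rowSum]

/-- Procedure 7: writes the middle candidates of the rows and their weights. -/
def rowvalsBody : Cmd :=
  .cond (.ltN 0 (N 1))
    (.call 4 2 6 [NM (N 0), NM (N 0 + 1), NM (N 0 + 2) + (NM (N 0 + 3) - NM (N 0 + 2)).half] [R 0] ++
      .storeR (N 2) (R 2) ++ .storeN (N 2) (NM (N 0 + 3) - NM (N 0 + 2)) ++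
      .call 4 2 7 [N 0 + 4, N 1 - 1, N 2 + 1] [R 0] ++ .setN 0 (N 4 + NM (N 2)))
    (.setN 0 0)

/-- The entry `x` of an array is the middle candidate of the row `r` with the weight of that row. -/
def IsMiddle (rm : ℕ → ℝ) (α : ℝ) (r : ℕ × ℕ × ℕ × ℕ) (x : ℝ × ℕ) : Prop :=
  x.2 = r.2.2.2 - r.2.2.1 ∧
    IsCritical rm α r.1 r.2.1 (r.2.2.1 + (r.2.2.2 - r.2.2.1) / 2) x.1

def rowvalsCost : ℕ := tryCost tentative + 200

/-- The reference memory `rm₀` fixes the meaning of the candidates while the actual memory changes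
above `d₀`. -/
theorem call_rowvals (h6 : procs[6]? = some candBody) (h7 : procs[7]? = some rowvalsBody)
    {α : ℝ} (hα : 0 < α) (rm₀ : ℕ → ℝ) (d₀ len b d : ℕ) (hd₀ : d₀ ≤ d) (hd : b + 4 * len ≤ d)
    (nm : ℕ → ℕ) (rm : ℕ → ℝ) (hrm : ∀ a < d₀, rm a = rm₀ a)
    (hrow : ∀ r ∈ rows nm b len, r.1 + 1 < d₀ ∧ r.2.1 + 1 < d₀ ∧ 0 ≤ rm₀ (r.1 + 1) ∧
      0 ≤ rm₀ (r.2.1 + 1)) :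
    Call procs 7 [b, len, d] [α] nm rm (fun m n _ nm' rm' =>
      (∀ a < d, nm' a = nm a) ∧ (∀ a < d, rm' a = rm a) ∧ n = rowSum (rows nm b len) ∧
      List.Forall₂ (IsMiddle rm₀ α) (rows nm b len) (arr nm' rm' d len) ∧
      m ≤ rowvalsCost * (len + 1)) := by
  induction len generalizing b d nm rm with
  | zero =>
    refine Call.intro h7 ?_
    simp [rowvalsBody, rowvalsCost]
  | succ len ih =>
    refine Call.intro h7 ?_
    simp only [rows_succ, List.mem_cons, forall_eq_or_imp] at hrow
    obtain ⟨⟨r1, r2, r3, r4⟩, hrow⟩ := hrow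
    simp [rowvalsBody, rows_succ]
    refine (call_cand h6 _ _ _ α hα nm rm (by rw [hrm _ r1]; exact r3)
      (by rw [hrm _ r2]; exact r4)).mono ?_
    rintro m n r nm' rm' ⟨rfl, rfl, hc, hm⟩
    have hcong : rows (Function.update nm' d (nm' (b + 3) - nm' (b + 2))) (b + 4) len =
        rows nm' (b + 4) len := rows_congr fun a h1 h2 => Function.update_of_ne (by omega) _ _
    refine (ih (b + 4) (d + 1) (by omega) (by omega) _ _ (fun a ha => ?_) ?_).mono ?_
    · rw [Function.update_of_ne (by omega), hrm a ha]
    · rwa [hcong]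
    · rintro m1 n1 r1' nm1 rm1 ⟨e1, e2, e3, e4, e5⟩
      rw [hcong] at e3 e4
      refine ⟨fun a h => ?_, fun a h => ?_, ?_, ⟨⟨?_, ?_⟩, e4⟩, ?_⟩
      · rw [e1 a (by omega), Function.update_of_ne (by omega)]
      · rw [e2 a (by omega), Function.update_of_ne (by omega)]
      · rw [e1 d (by omega), Function.update_self, e3, add_comm]
      · simp only [e1 d (by omega), Function.update_self]
      · simp only [e2 d (by omega), Function.update_self, IsCritical]
        rw [hrm _ r1, hrm _ r2, hrm _ (by omega), hrm _ (by omega)] at hc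
        exact hc
      · unfold rowvalsCost at e5 ⊢
        generalize tryCost tentative = C at *
        rw [Nat.mul_succ]
        omega

open scoped Classical in
/-- What remains of a row with the middle candidate `x` when the interval is `(lo, hi)`. -/
noncomputable def pruneRow (lo hi x : ℝ) (r : ℕ × ℕ × ℕ × ℕ) : ℕ × ℕ × ℕ × ℕ :=
  if x ≤ lo then (r.1, r.2.1, r.2.2.1, r.2.2.1 + (r.2.2.2 - r.2.2.1) / 2)
  else if hi ≤ x then (r.1, r.2.1, r.2.2.1 + (r.2.2.2 - r.2.2.1) / 2 + 1, r.2.2.2) else r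

/-- What remains of a list of rows with middle candidates. -/
noncomputable def pruneRows (lo hi : ℝ) (l : List (ℕ × ℕ × ℕ × ℕ)) (xs : List (ℝ × ℕ)) :
    List (ℕ × ℕ × ℕ × ℕ) :=
  (List.zipWith (fun r x => pruneRow lo hi x.1 r) l xs).filter (fun r => r.2.2.1 < r.2.2.2)

/-- Writes what remains of a row and goes on with the next one. -/
def pruneTail : Cmd :=
  .cond (.ltN (N 4) (N 5))
    (.storeN (N 3) (N 7) ++ .storeN (N 3 + 1) (N 8) ++ .storeN (N 3 + 2) (N 4) ++
      .storeN (N 3 + 3) (N 5) ++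
      .call 9 3 8 [N 0 + 4, N 1 - 1, N 2 + 1, N 3 + 4] [R 0, R 1] ++ .setN 0 (N 9 + 1))
    (.call 0 3 8 [N 0 + 4, N 1 - 1, N 2 + 1, N 3] [R 0, R 1])

/-- Procedure 8: removes candidates from the rows, in place. -/
def pruneBody : Cmd :=
  .cond (.ltN 0 (N 1))
    (.setN 4 (NM (N 0 + 2)) ++ .setN 5 (NM (N 0 + 3)) ++ .setN 6 (N 4 + (N 5 - N 4).half) ++
      .setN 7 (NM (N 0)) ++ .setN 8 (NM (N 0 + 1)) ++ .setR 2 (RM (N 2)) ++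
      .cond (.not (.ltR (R 0) (R 2))) (.setN 5 (N 6))
        (.cond (.not (.ltR (R 2) (R 1))) (.setN 4 (N 6 + 1)) .skip) ++
      pruneTail)
    (.setN 0 0)

theorem wp_pruneTail (len b p d i j l h : ℕ) (hd : d ≤ b) (lo hi : ℝ) (nm : ℕ → ℕ) (rm : ℕ → ℝ)
    (xs : List (ℝ × ℕ)) (rest : List (ℕ × ℕ × ℕ × ℕ)) (hrest : rest = rows nm (b + 4) len)
    (ih : ∀ (d : ℕ), d ≤ b + 4 → ∀ (nm : ℕ → ℕ), Call procs 8 [b + 4, len, p + 1, d] [lo, hi] nm rm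
      (fun m n _ nm' rm' => (∀ a < d, nm' a = nm a) ∧ rm' = rm ∧
        rows nm' d n = pruneRows lo hi (rows nm (b + 4) len) xs ∧ m ≤ 300 * (len + 1)))
    (s : State) (h0 : s.nvar 0 = b) (h1 : s.nvar 1 = len + 1) (h2 : s.nvar 2 = p)
    (h3 : s.nvar 3 = d) (h4 : s.nvar 4 = l) (h5 : s.nvar 5 = h) (h7 : s.nvar 7 = i)
    (h8 : s.nvar 8 = j) (r0 : s.rvar 0 = lo) (r1 : s.rvar 1 = hi) (hnm : s.nmem = nm)
    (hrm : s.rmem = rm) :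
    Wp procs pruneTail s
      (fun m t => (∀ a < d, t.nmem a = nm a) ∧ t.rmem = rm ∧
        rows t.nmem d (t.nvar 0) = (if l < h then [(i, j, l, h)] else []) ++
          pruneRows lo hi rest xs ∧
        m ≤ 300 * (len + 1) + 100) := by
  subst hnm hrm
  simp [pruneTail, h0, h1, h2, h3, h4, h5, h7, h8, r0, r1]
  split_ifs with hlt
  · refine (ih (d + 4) (by omega) _).mono ?_
    rintro m n r nm' rm' ⟨e1, rfl, e2, e3⟩
    refine ⟨fun a ha => ?_, rfl, ?_, by omega⟩
    · rw [e1 a (by omega)]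
      repeat rw [Function.update_of_ne (by omega)]
    · rw [rows_succ, e2, hrest, rows_congr (nm := s.nmem) (len := len)]
      · rw [e1 _ (by omega), e1 _ (by omega), e1 _ (by omega), e1 _ (by omega)]
        simp
      · intro a ha1 ha2
        repeat rw [Function.update_of_ne (by omega)]
  · refine (ih d (by omega) _).mono ?_
    rintro m n r nm' rm' ⟨e1, rfl, e2, e3⟩
    refine ⟨e1, rfl, ?_, by omega⟩
    simp [e2, hrest]

/-- With `d ≤ b`, writing never overtakes reading, so compaction in place is safe. Pruning ignores
the weights, so `nm₀` is arbitrary. -/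
theorem call_prune (h8 : procs[8]? = some pruneBody) (lo hi : ℝ) (rm : ℕ → ℝ) (nm₀ : ℕ → ℕ)
    (len b p d : ℕ) (hd : d ≤ b) (nm : ℕ → ℕ) :
    Call procs 8 [b, len, p, d] [lo, hi] nm rm (fun m n _ nm' rm' =>
      (∀ a < d, nm' a = nm a) ∧ rm' = rm ∧
      rows nm' d n = pruneRows lo hi (rows nm b len) (arr nm₀ rm p len) ∧
      m ≤ 300 * (len + 1)) := by
  induction len generalizing b p d nm with
  | zero =>
    refine Call.intro h8 ?_
    simp [pruneBody, pruneRows]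
  | succ len ih =>
    refine Call.intro h8 ?_
    have key := fun i j l h => wp_pruneTail len b p d i j l h hd lo hi nm rm
      (arr nm₀ rm (p + 1) len) _ rfl (fun d hd nm => ih (b + 4) (p + 1) d hd nm)
    have hrow : pruneRows lo hi (rows nm b (len + 1)) (arr nm₀ rm p (len + 1)) =
        (if (pruneRow lo hi (rm p) (nm b, nm (b + 1), nm (b + 2), nm (b + 3))).2.2.1 <
          (pruneRow lo hi (rm p) (nm b, nm (b + 1), nm (b + 2), nm (b + 3))).2.2.2 then
          [pruneRow lo hi (rm p) (nm b, nm (b + 1), nm (b + 2), nm (b + 3))] else []) ++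
        pruneRows lo hi (rows nm (b + 4) len) (arr nm₀ rm (p + 1) len) := by
      rw [rows_succ, arr_succ, pruneRows, List.zipWith_cons_cons, List.filter_cons]
      simp only [decide_eq_true_eq]
      split_ifs <;> rfl
    rw [hrow]
    by_cases c1 : rm p ≤ lo
    · simp [pruneBody, c1]
      refine (key (nm b) (nm (b + 1)) (nm (b + 2)) (nm (b + 2) + (nm (b + 3) - nm (b + 2)) / 2)
        _ rfl rfl rfl rfl rfl rfl rfl rfl rfl rfl rfl rfl).mono ?_
      rintro m t ⟨e1, e2, e3, e4⟩
      exact ⟨e1, e2, by simpa [pruneRow, c1] using e3, by omega⟩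
    · by_cases c2 : hi ≤ rm p
      · simp [pruneBody, c1, c2]
        refine (key (nm b) (nm (b + 1)) (nm (b + 2) + (nm (b + 3) - nm (b + 2)) / 2 + 1)
          (nm (b + 3)) _ rfl rfl rfl rfl rfl rfl rfl rfl rfl rfl rfl rfl).mono ?_
        rintro m t ⟨e1, e2, e3, e4⟩
        exact ⟨e1, e2, by simpa [pruneRow, c1, c2] using e3, by omega⟩
      · simp [pruneBody, c1, c2]
        refine (key (nm b) (nm (b + 1)) (nm (b + 2)) (nm (b + 3))
          _ rfl rfl rfl rfl rfl rfl rfl rfl rfl rfl rfl rfl).mono ?_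
        rintro m t ⟨e1, e2, e3, e4⟩
        exact ⟨e1, e2, by simpa [pruneRow, c1, c2] using e3, by omega⟩

/-! ### The search for the optimal radius -/

theorem mem_pairs {rm : ℕ → ℝ} {b len : ℕ} {p : ℝ × ℝ} :
    p ∈ pairs rm b len ↔ ∃ i < len, p = (rm (b + 2 * i), rm (b + 2 * i + 1)) := by
  induction len generalizing b with
  | zero => simp
  | succ len ih =>
    rw [pairs_succ, List.mem_cons, ih]
    constructor
    · rintro (rfl | ⟨i, hi, rfl⟩)
      · exact ⟨0, by omega, rfl⟩
      · exact ⟨i + 1, by omega, by rw [show b + 2 + 2 * i = b + 2 * (i + 1) by ring]⟩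
    · rintro ⟨i, hi, rfl⟩
      rcases i with _ | i
      · exact .inl rfl
      · exact .inr ⟨i, by omega, by rw [show b + 2 + 2 * i = b + 2 * (i + 1) by ring]⟩

/-- The data of the search: `n` sorted points and the two ends of the segment, seen as points that
are so far from the line that they do not matter. -/
structure Instance (rm : ℕ → ℝ) (n k s B : ℕ) (α L H : ℝ) : Prop where
  pos : 0 < α
  sorted : (pairs rm 0 n).Pairwise (fun x y => x.1 ≤ y.1)
  ends : pairs rm 0 (n + 2) = pairs rm 0 n ++ [(0, H ^ 2), (L, H ^ 2)]
  nonneg : ∀ i < n + 2, 0 ≤ rm (2 * i + 1)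
  le : 2 * n + 4 ≤ B
  lt : k < 2 ^ s

/-- The rows `l` contain all candidates that lie strictly between the feasible radius `lo` and the
infeasible radius `hi`. -/
structure Bracket (rm : ℕ → ℝ) (n k : ℕ) (α L H : ℝ) (l : List (ℕ × ℕ × ℕ × ℕ)) (lo hi : ℝ) :
    Prop where
  row : ∀ r ∈ l, (∃ i < n + 2, r.1 = 2 * i) ∧ (∃ j < n + 2, r.2.1 = 2 * j) ∧ r.2.2.1 < r.2.2.2
  nonneg : 0 ≤ lo
  lt : lo < hi
  le : hi ≤ H
  feas : Feas (pairs rm 0 n) L α k lo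
  not_feas : ¬ Feas (pairs rm 0 n) L α k hi
  mem : ∀ i < n + 2, ∀ j < n + 2, ∀ m < k, ∀ c, IsCritical rm α (2 * i) (2 * j) m c → lo < c →
    c < hi → ∃ r ∈ l, r.1 = 2 * i ∧ r.2.1 = 2 * j ∧ r.2.2.1 ≤ m ∧ m < r.2.2.2

section search

variable {rm₀ : ℕ → ℝ} {n k s B : ℕ} {α L H : ℝ}

theorem Bracket.optimal (hI : Instance rm₀ n k s B α L H) {lo hi : ℝ}
    (h : Bracket rm₀ n k α L H [] lo hi) (v : ℝ) (hv : lo < v) :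
    ¬ Feas (pairs rm₀ 0 n) L α k v := by
  rcases lt_or_ge v hi with hvhi | hvhi
  · refine not_feas_of_thresholds hI.pos h.nonneg h.le h.not_feas ?_ hv hvhi
    rw [← hI.ends]
    intro p hp q hq m hm
    obtain ⟨i, hi, rfl⟩ := mem_pairs.1 hp
    obtain ⟨j, hj, rfl⟩ := mem_pairs.1 hq
    simp only [zero_add]
    obtain ⟨c, hc⟩ := exists_isCritical rm₀ hI.pos (2 * i) (2 * j) m (hI.nonneg i hi)
      (hI.nonneg j hj)
    refine ⟨c, hc, ?_⟩
    by_contra! hcon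
    obtain ⟨r, hr, -⟩ := h.mem i hi j hj m hm c hc hcon.1 hcon.2
    simp at hr
  · exact fun hf => h.not_feas (hf.anti (h.nonneg.trans h.lt.le) hvhi)

theorem exists_of_mem_pruneRows {lo hi : ℝ} {l : List (ℕ × ℕ × ℕ × ℕ)} {xs : List (ℝ × ℕ)}
    {r' : ℕ × ℕ × ℕ × ℕ} (h : r' ∈ pruneRows lo hi l xs) :
    r'.2.2.1 < r'.2.2.2 ∧ ∃ r ∈ l, r'.1 = r.1 ∧ r'.2.1 = r.2.1 := by
  unfold pruneRows at h
  rw [List.mem_filter] at h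
  refine ⟨by simpa using h.2, ?_⟩
  have h1 := h.1
  clear h
  induction l generalizing xs with
  | nil => simp at h1
  | cons r l ih =>
    rcases xs with _ | ⟨x, xs⟩
    · simp at h1
    · rw [List.zipWith_cons_cons, List.mem_cons] at h1
      rcases h1 with rfl | h1
      · refine ⟨r, List.mem_cons_self, ?_⟩
        unfold pruneRow
        split_ifs <;> simp
      · obtain ⟨r0, h2, h3⟩ := ih h1
        exact ⟨r0, List.mem_cons_of_mem _ h2, h3⟩

theorem mem_pruneRows {lo hi : ℝ} {l : List (ℕ × ℕ × ℕ × ℕ)} {xs : List (ℝ × ℕ)}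
    {S : ℕ × ℕ × ℕ × ℕ → ℝ × ℕ → Prop} (h : List.Forall₂ S l xs) {r : ℕ × ℕ × ℕ × ℕ} (hr : r ∈ l) :
    ∃ x, S r x ∧ ((pruneRow lo hi x.1 r).2.2.1 < (pruneRow lo hi x.1 r).2.2.2 →
      pruneRow lo hi x.1 r ∈ pruneRows lo hi l xs) := by
  induction h with
  | nil => simp at hr
  | @cons r0 x l xs h1 h2 ih =>
    rcases List.mem_cons.1 hr with rfl | hr
    · refine ⟨x, h1, fun hlt => ?_⟩
      rw [pruneRows, List.zipWith_cons_cons, List.filter_cons_of_pos (by simpa using hlt)]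
      exact List.mem_cons_self
    · obtain ⟨y, h3, h4⟩ := ih hr
      refine ⟨y, h3, fun hlt => ?_⟩
      rw [pruneRows, List.zipWith_cons_cons, List.filter_cons]
      split_ifs
      exacts [List.mem_cons_of_mem _ (h4 hlt), h4 hlt]

/-- By monotonicity along the row, a middle candidate `≤ lo'` rules out itself and all larger `m`,
and one `≥ hi'` rules out itself and all smaller `m`. -/
theorem Bracket.prune (hα : 0 < α) {l : List (ℕ × ℕ × ℕ × ℕ)} {xs : List (ℝ × ℕ)}
    {lo hi lo' hi' : ℝ}
    (h : Bracket rm₀ n k α L H l lo hi) (hxs : List.Forall₂ (IsMiddle rm₀ α) l xs)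
    (hlo : lo ≤ lo') (hhi : hi' ≤ hi) (hlt : lo' < hi') (h1 : Feas (pairs rm₀ 0 n) L α k lo')
    (h2 : ¬ Feas (pairs rm₀ 0 n) L α k hi') :
    Bracket rm₀ n k α L H (pruneRows lo' hi' l xs) lo' hi' where
  row r hr := by
    obtain ⟨e1, r0, hr0, e2, e3⟩ := exists_of_mem_pruneRows hr
    rw [e2, e3]
    exact ⟨(h.row r0 hr0).1, (h.row r0 hr0).2.1, e1⟩
  nonneg := h.nonneg.trans hlo
  lt := hlt
  le := hhi.trans h.le
  feas := h1
  not_feas := h2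
  mem i hi0 j hj m hm c hc hc1 hc2 := by
    obtain ⟨r, hr, e1, e2, e3, e4⟩ := h.mem i hi0 j hj m hm c hc (hlo.trans_lt hc1)
      (hc2.trans_le hhi)
    obtain ⟨x, ⟨-, hx⟩, hmem⟩ := mem_pruneRows (lo := lo') (hi := hi') hxs hr
    rw [e1, e2] at hx
    have hc0 : 0 ≤ c := (h.nonneg.trans hlo).trans hc1.le
    have main : (pruneRow lo' hi' x.1 r).1 = 2 * i ∧ (pruneRow lo' hi' x.1 r).2.1 = 2 * j ∧
        (pruneRow lo' hi' x.1 r).2.2.1 ≤ m ∧ m < (pruneRow lo' hi' x.1 r).2.2.2 := by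
      unfold pruneRow
      split_ifs with c1 c2
      · refine ⟨e1, e2, e3, ?_⟩
        by_contra! hcon
        have := hx.le_of_le hα hc hcon hc0
        linarith
      · refine ⟨e1, e2, ?_, e4⟩
        by_contra! hcon
        dsimp only at hcon
        have := hc.le_of_le hα hx (by omega) (by linarith)
        linarith
      · exact ⟨e1, e2, e3, e4⟩
    exact ⟨_, hmem (main.2.2.1.trans_lt main.2.2.2), main⟩

theorem rowSum_eq_of_middle {l : List (ℕ × ℕ × ℕ × ℕ)} {xs : List (ℝ × ℕ)}
    (h : List.Forall₂ (IsMiddle rm₀ α) l xs) : (xs.map Prod.snd).sum = rowSum l := by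
  induction h with
  | nil => rfl
  | cons h1 h2 ih => simp [ih, h1.1]

/-- A row whose middle candidate is outside the bracket keeps at most half of its candidates. -/
theorem rowSum_pruneRows {l : List (ℕ × ℕ × ℕ × ℕ)} {xs : List (ℝ × ℕ)} {lo hi : ℝ} {P : ℝ → Prop}
    (h : List.Forall₂ (IsMiddle rm₀ α) l xs) (hP : ∀ x, P x → x ≤ lo ∨ hi ≤ x) :
    2 * rowSum (pruneRows lo hi l xs) + wt xs P ≤ 2 * rowSum l := by
  classical
  induction h with
  | nil => simp [pruneRows]
  | @cons r x l xs h1 h2 ih =>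
    have e : rowSum (pruneRows lo hi (r :: l) (x :: xs)) ≤
        ((pruneRow lo hi x.1 r).2.2.2 - (pruneRow lo hi x.1 r).2.2.1) +
        rowSum (pruneRows lo hi l xs) := by
      rw [pruneRows, List.zipWith_cons_cons, List.filter_cons]
      split_ifs
      · rw [rowSum_cons]; rfl
      · exact Nat.le_add_left _ _
    have e2 : 2 * ((pruneRow lo hi x.1 r).2.2.2 - (pruneRow lo hi x.1 r).2.2.1) +
        (if P x.1 then x.2 else 0) ≤ 2 * (r.2.2.2 - r.2.2.1) := by
      have := hP x.1
      rw [h1.1]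
      unfold pruneRow
      split_ifs with c1 c2 c3 c4 <;> try dsimp only
      all_goals first | omega | (exfalso; tauto)
    rw [wt_cons, rowSum_cons]
    omega

/-- `log x ≤ x - 1` bounds the drop of the logarithm below by `(y - y') / (1 + y)`. Here `y - y' ≥ y
/ 4` and `y / (1 + y) ≥ min y 1 / 2`, whence `8`. -/
theorem min_one_le_log {y y' : ℝ} (hy' : 0 ≤ y') (h : 4 * y' ≤ 3 * y) :
    min y 1 ≤ 8 * (Real.log (1 + y) - Real.log (1 + y')) := by
  have hy : 0 ≤ y := by linarith
  have h1 := Real.log_le_sub_one_of_pos (show 0 < (1 + y') / (1 + y) by positivity)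
  rw [Real.log_div (by positivity) (by positivity)] at h1
  have h2 : (1 + y') / (1 + y) ≤ 1 - min y 1 / 8 := by
    rw [div_le_iff₀ (by positivity)]
    rcases le_total y 1 with e | e
    · rw [min_eq_left e]; nlinarith
    · rw [min_eq_right e]; nlinarith
  linarith

/-- Procedure 9: the search.  The natural arguments are the number of rows, the address of free
memory, and the numbers of points and centers. -/
def searchBody : Cmd :=
  .cond (.ltN 0 (N 0))
    (.call 4 5 7 [0, N 0, N 1] [R 2] ++
      (.call 5 4 3 [N 1, N 0, N 4, (N 4).half] [] ++
      (.cond (.and (.ltR (R 0) (R 4)) (.ltR (R 4) (R 1)))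
        (.call 5 5 5 [0, N 2, N 3] [R 4, R 4 / R 2, 0, R 3] ++
          .cond (.ltN 0 (N 5)) (.setR 1 (R 4)) (.setR 0 (R 4)))
        .skip ++
      (.call 0 5 8 [0, N 0, N 1, 0] [R 0, R 1] ++
      .call 4 0 9 [N 0, N 1, N 2, N 3] [R 0, R 1, R 2, R 3]))))
    .skip

/-- A bound for the steps of one round of the search per row. -/
def roundCost : ℕ := 2 * rowvalsCost + selCost + 800

theorem length_le_rowSum {l : List (ℕ × ℕ × ℕ × ℕ)} (h : ∀ r ∈ l, r.2.2.1 < r.2.2.2) :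
    l.length ≤ rowSum l := by
  induction l with
  | nil => simp
  | cons r l ih =>
    have h1 := ih (fun r hr => h r (List.mem_cons_of_mem _ hr))
    have h2 := h r List.mem_cons_self
    rw [rowSum_cons, List.length_cons]
    omega

theorem length_pruneRows_le {lo hi : ℝ} {l : List (ℕ × ℕ × ℕ × ℕ)} {xs : List (ℝ × ℕ)} :
    (pruneRows lo hi l xs).length ≤ l.length := by
  refine (List.length_filter_le _ _).trans ?_
  simp

/-- The bound for the steps of the search with `N` candidates in `Rc ≤ R₀` rows. -/
noncomputable def searchCost (R₀ E N : ℝ) : ℝ :=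
  roundCost * (8 * (R₀ * Real.log (1 + N / R₀))) + 1000 * (E * (8 * Real.log (1 + N))) + 10

/-- The potential pays for a round: its first term drops enough for `Rc ≤ R₀ * min (N / R₀) 1` rows,
its second for one decision. -/
theorem searchCost_step {R₀ E Rc N N' : ℝ} (hR₀ : 0 < R₀) (hE : 0 ≤ E) (hRc : Rc ≤ R₀) (hN : 1 ≤ N)
    (hRcN : Rc ≤ N) (hN' : 0 ≤ N') (h : 4 * N' ≤ 3 * N) :
    searchCost R₀ E N' + (roundCost * Rc + 1000 * E) ≤ searchCost R₀ E N := by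
  have h1 := min_one_le_log (y := N / R₀) (y' := N' / R₀) (by positivity) (by
    rw [mul_div_assoc', mul_div_assoc']; gcongr)
  have h2 := min_one_le_log hN' h
  rw [min_eq_right hN] at h2
  have h3 : Rc ≤ R₀ * min (N / R₀) 1 := by
    rw [mul_min_of_nonneg _ _ hR₀.le]
    refine le_min ?_ (by linarith)
    rw [mul_div_cancel₀ _ hR₀.ne']
    exact hRcN
  have h4 : Rc ≤ R₀ * (8 * (Real.log (1 + N / R₀) - Real.log (1 + N' / R₀))) :=
    h3.trans (by gcongr)
  have h5 : E * 1 ≤ E * (8 * (Real.log (1 + N) - Real.log (1 + N'))) := by gcongr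
  have h6 : roundCost * Rc ≤
      roundCost * (R₀ * (8 * (Real.log (1 + N / R₀) - Real.log (1 + N' / R₀)))) :=
    mul_le_mul_of_nonneg_left h4 (by positivity)
  unfold searchCost
  linarith

/-- One round of the search narrows the bracket, halving at least half of the rows by weight. -/
theorem Bracket.round (hI : Instance rm₀ n k s B α L H) {l : List (ℕ × ℕ × ℕ × ℕ)}
    {xs : List (ℝ × ℕ)} {lo hi lo' hi' v : ℝ} (h : Bracket rm₀ n k α L H l lo hi)
    (hxs : List.Forall₂ (IsMiddle rm₀ α) l xs) (h1 : wt xs (· < v) ≤ rowSum l / 2)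
    (h2 : rowSum l / 2 < wt xs (· ≤ v)) (hlo : lo ≤ lo') (hhi : hi' ≤ hi) (hlt : lo' < hi')
    (hf : Feas (pairs rm₀ 0 n) L α k lo') (hnf : ¬ Feas (pairs rm₀ 0 n) L α k hi')
    (hv : v ≤ lo' ∨ hi' ≤ v) :
    Bracket rm₀ n k α L H (pruneRows lo' hi' l xs) lo' hi' ∧
      4 * rowSum (pruneRows lo' hi' l xs) ≤ 3 * rowSum l := by
  refine ⟨h.prune hI.pos hxs hlo hhi hlt hf hnf, ?_⟩
  rcases hv with hv | hv
  · have := rowSum_pruneRows (P := (· ≤ v)) hxs (lo := lo') (hi := hi') fun x hx => .inl (hx.trans hv)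
    omega
  · have := rowSum_pruneRows (P := (v ≤ ·)) hxs (lo := lo') (hi := hi') fun x hx => .inr (hv.trans hx)
    have e := wt_add_of_disjoint (l := xs) (P := (· < v)) (Q := (v ≤ ·)) (U := fun _ => True)
      (fun x => by simp [lt_or_ge]) (fun x => not_le.2)
    rw [wt_true, rowSum_eq_of_middle hxs] at e
    omega

/-- The result `r` of the search. -/
def IsOptimum (pts : List (ℝ × ℝ)) (L α : ℝ) (k : ℕ) (r : ℝ) : Prop :=
  0 ≤ r ∧ Feas pts L α k r ∧ ∀ v, r < v → ¬ Feas pts L α k v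

theorem call_search (h0 : procs[0]? = some weighBody) (h1 : procs[1]? = some filtBody)
    (h2 : procs[2]? = some med9Body) (h3 : procs[3]? = some selBody)
    (h4 : procs[4]? = some bsearchBody) (h5 : procs[5]? = some decBody)
    (h6 : procs[6]? = some candBody) (h7 : procs[7]? = some rowvalsBody)
    (h8 : procs[8]? = some pruneBody) (h9 : procs[9]? = some searchBody)
    (hI : Instance rm₀ n k s B α L H) {R₀ : ℝ} (hR₀ : 0 < R₀) (W Rc : ℕ) (lo hi : ℝ) (nm : ℕ → ℕ)
    (rm : ℕ → ℝ) (hrm : ∀ a < B, rm a = rm₀ a) (hB : 4 * Rc ≤ B) (hRc : (Rc : ℝ) ≤ R₀)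
    (hW : rowSum (rows nm 0 Rc) = W) (hbr : Bracket rm₀ n k α L H (rows nm 0 Rc) lo hi) :
    Call procs 9 [Rc, B, n, k] [lo, hi, α, L] nm rm (fun m _ r _ _ =>
      IsOptimum (pairs rm₀ 0 n) L α k r ∧ (m : ℝ) ≤ searchCost R₀ ((s + 1) * (n + 1) : ℕ) W) := by
  induction W using Nat.strong_induction_on generalizing Rc lo hi nm rm with
  | _ W ih =>
  rcases Nat.eq_zero_or_pos Rc with rfl | hpos
  · refine Call.intro h9 ?_
    simp [searchBody]
    refine ⟨⟨hbr.nonneg, hbr.feas, hbr.optimal hI⟩, ?_⟩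
    have := Real.log_nonneg (show (1 : ℝ) ≤ 1 + W / R₀ by linarith [show 0 ≤ W / R₀ by positivity])
    have := Real.log_nonneg (show (1 : ℝ) ≤ 1 + W by linarith [show (0 : ℝ) ≤ W by positivity])
    unfold searchCost
    have : (0 : ℝ) ≤ roundCost * (8 * (R₀ * Real.log (1 + W / R₀))) := by positivity
    have : (0 : ℝ) ≤ 1000 * (((s + 1) * (n + 1) : ℕ) * (8 * Real.log (1 + (W : ℝ)))) := by positivity
    norm_num
    push_cast at *
    linarith
  have hRcW : Rc ≤ W := by
    rw [← hW]
    simpa using length_le_rowSum fun r hr => (hbr.row r hr).2.2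
  refine Call.intro h9 ?_
  simp [searchBody, hpos]
  refine (call_rowvals h6 h7 hI.pos rm₀ (2 * n + 4) Rc 0 B hI.le (by omega) nm rm
    (fun a ha => hrm a (ha.trans_le hI.le)) ?_).mono ?_
  · intro r hr
    obtain ⟨⟨i, hi, e1⟩, ⟨j, hj, e2⟩, -⟩ := hbr.row r hr
    rw [e1, e2]
    exact ⟨by omega, by omega, hI.nonneg i hi, hI.nonneg j hj⟩
  rintro m1 W1 - nm1 rm1 ⟨hnm1, hrm1, rfl, hmid, hm1⟩
  rw [hW]
  refine (selSpec h0 h1 h2 h3 Rc B W (W / 2) nm1 rm1 ((rowSum_eq_of_middle hmid).trans hW)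
    (by omega)).mono ?_
  rintro m2 - v nm2 rm2 ⟨hnm2, hrm2, hlt, hle, hm2⟩
  rw [← hW] at hlt hle
  have hmem : ∀ a < B, rm2 a = rm₀ a := fun a ha => by
    rw [hrm2 a (by omega), hrm1 a ha, hrm a ha]
  have hpairs : pairs rm2 0 n = pairs rm₀ 0 n :=
    pairs_congr fun a _ h => hmem a (by have := hI.le; omega)
  have hrows : rows nm2 0 Rc = rows nm 0 Rc :=
    rows_congr fun a _ h => by rw [hnm2 a (by omega), hnm1 a (by omega)]
  have harr : arr nm2 rm2 B Rc = arr nm1 rm1 B Rc :=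
    arr_congr (fun a _ h => hnm2 a h) (fun a _ h => hrm2 a h)
  -- The rest of the round is the same in all three cases: median infeasible, feasible, or already
  -- outside the bracket, when no decision is needed.
  have main : ∀ (m3 : ℕ) (lo' hi' : ℝ), lo ≤ lo' → hi' ≤ hi → lo' < hi' →
      Feas (pairs rm₀ 0 n) L α k lo' → ¬ Feas (pairs rm₀ 0 n) L α k hi' → (v ≤ lo' ∨ hi' ≤ v) →
      m3 ≤ 1000 * ((s + 1) * (n + 1)) + 60 →
      Call procs 8 [0, Rc, B, 0] [lo', hi'] nm2 rm2 (fun m4 n4 _ nm4 rm4 =>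
        Call procs 9 [n4, B, n, k] [lo', hi', α, L] nm4 rm4 (fun m5 _ r _ _ =>
          IsOptimum (pairs rm₀ 0 n) L α k r ∧ ((m1 + m2 + m3 + m4 + m5 + 100 : ℕ) : ℝ) ≤
            searchCost R₀ ((s + 1) * (n + 1) : ℕ) W)) := by
    intro m3 lo' hi' a1 a2 a3 a4 a5 a6 a7
    obtain ⟨hb, hsum⟩ := hbr.round hI hmid hlt hle a1 a2 a3 a4 a5 a6
    refine (call_prune h8 lo' hi' rm2 nm2 Rc 0 B 0 le_rfl nm2).mono ?_
    rintro m4 n4 - nm4 rm4 ⟨-, rfl, e, hm4⟩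
    rw [hrows, harr] at e
    rw [← e] at hb hsum
    have hn4 : n4 ≤ Rc := by
      have := length_pruneRows_le (lo := lo') (hi := hi') (l := rows nm 0 Rc) (xs := arr nm1 rm1 B Rc)
      rwa [← e, length_rows, length_rows] at this
    rw [hW] at hsum
    refine (ih _ (by omega) n4 lo' hi' nm4 rm4 hmem (by omega)
      (le_trans (by exact_mod_cast hn4) hRc) rfl hb).mono ?_
    rintro m5 - r - - ⟨b1, b2⟩
    refine ⟨b1, ?_⟩
    have hst := searchCost_step (E := ((s + 1) * (n + 1) : ℕ)) hR₀ (Nat.cast_nonneg _) hRc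
      (N := W) (N' := rowSum (rows nm4 0 n4)) (by exact_mod_cast hpos.trans_le hRcW)
      (by exact_mod_cast hRcW) (Nat.cast_nonneg _) (by exact_mod_cast hsum)
    have hm : m1 + m2 + m3 + m4 + 100 ≤ roundCost * Rc + 1000 * ((s + 1) * (n + 1)) := by
      have e : roundCost * Rc = 2 * (rowvalsCost * Rc) + selCost * Rc + 800 * Rc := by
        unfold roundCost; ring
      have e1 : rowvalsCost * 1 ≤ rowvalsCost * Rc := Nat.mul_le_mul_left _ hpos
      rw [Nat.mul_add] at hm1
      omega
    have hm' : ((m1 + m2 + m3 + m4 + 100 : ℕ) : ℝ) ≤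
      roundCost * Rc + 1000 * ((s + 1) * (n + 1) : ℕ) := by exact_mod_cast hm
    push_cast at *
    linarith
  split_ifs with hv
  · refine (call_dec h4 h5 (div_nonneg (hbr.nonneg.trans hv.1.le) hI.pos.le) v L k s hI.lt nm2 rm2 n 0 0
      (by rw [hpairs]; exact hI.sorted)).mono ?_
    rintro m3 n3 y nm3 rm3 ⟨rfl, rfl, hG, hGn, hm3⟩
    rw [hpairs] at hG hGn
    have hiff := hG.eq_zero_iff_feas hI.pos hGn
    split_ifs with hn3
    · refine (main (m3 + 50) lo v le_rfl hv.2.le hv.1 hbr.feas (fun h => by have := hiff.2 h; omega)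
        (.inr le_rfl) (by omega)).mono ?_
      rintro m4 n4 r4 nm4 rm4 h
      refine h.mono ?_
      rintro m5 - r - - ⟨b1, b2⟩
      refine ⟨b1, le_trans ?_ (b2.trans_eq (by push_cast; rfl))⟩
      norm_cast
      omega
    · refine (main (m3 + 50) v hi hv.1.le le_rfl hv.2 (hiff.1 (by omega)) hbr.not_feas
        (.inl le_rfl) (by omega)).mono ?_
      rintro m4 n4 r4 nm4 rm4 h
      refine h.mono ?_
      rintro m5 - r - - ⟨b1, b2⟩
      refine ⟨b1, le_trans ?_ (b2.trans_eq (by push_cast; rfl))⟩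
      norm_cast
      omega
  · refine (main 50 lo hi le_rfl le_rfl hbr.lt hbr.feas hbr.not_feas ?_ (by omega)).mono ?_
    · by_contra! h
      exact hv h
    rintro m4 n4 r4 nm4 rm4 h
    refine h.mono ?_
    rintro m5 - r - - ⟨b1, b2⟩
    refine ⟨b1, le_trans ?_ (b2.trans_eq (by push_cast; rfl))⟩
    norm_cast
    omega

end search

/-! ### Preparation of the search -/

theorem pairs_add (rm : ℕ → ℝ) (b m n : ℕ) :
    pairs rm b (m + n) = pairs rm b m ++ pairs rm (b + 2 * m) n := by
  induction m generalizing b with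
  | zero => simp
  | succ m ih =>
    rw [show m + 1 + n = (m + n) + 1 by ring, pairs_succ, pairs_succ, ih, List.cons_append,
      show b + 2 + 2 * m = b + 2 * (m + 1) by ring]

theorem rows_add (nm : ℕ → ℕ) (b m n : ℕ) :
    rows nm b (m + n) = rows nm b m ++ rows nm (b + 4 * m) n := by
  induction m generalizing b with
  | zero => simp
  | succ m ih =>
    rw [show m + 1 + n = (m + n) + 1 by ring, rows_succ, rows_succ, ih, List.cons_append,
      show b + 4 + 4 * m = b + 4 * (m + 1) by ring]

/-- Procedure 10: inserts a pair into a sorted array, which is moved to the left as needed. -/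
def sinkBody : Cmd :=
  .cond (.and (.ltN 0 (N 1)) (.ltR (RM (N 0 + 2)) (R 0)))
    (.storeR (N 0) (RM (N 0 + 2)) ++ .storeR (N 0 + 1) (RM (N 0 + 3)) ++
      .call 2 2 10 [N 0 + 2, N 1 - 1] [R 0, R 1])
    (.storeR (N 0) (R 0) ++ .storeR (N 0 + 1) (R 1))

/-- Procedure 11: insertion sort. -/
def sortBody : Cmd :=
  .cond (.ltN 0 (N 1))
    (.call 2 2 11 [N 0 + 2, N 1 - 1] [] ++
      .call 2 2 10 [N 0, N 1 - 1] [RM (N 0), RM (N 0 + 1)])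
    .skip

open scoped Classical in
theorem call_sink (h10 : procs[10]? = some sinkBody) (x w : ℝ) (nm : ℕ → ℕ) (len b : ℕ)
    (rm : ℕ → ℝ) :
    Call procs 10 [b, len] [x, w] nm rm (fun m _ _ _ rm' => (∀ a < b, rm' a = rm a) ∧
      pairs rm' b (len + 1) =
        (pairs rm (b + 2) len).orderedInsert (fun x y => x.1 ≤ y.1) (x, w) ∧
      m ≤ 50 * (len + 1)) := by
  induction len generalizing b rm with
  | zero =>
    refine Call.intro h10 ?_
    simp [sinkBody, pairs_succ]
    intro a ha
    rw [Function.update_of_ne (by omega), Function.update_of_ne (by omega)]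
  | succ len ih =>
    refine Call.intro h10 ?_
    simp [sinkBody]
    split_ifs with h
    · refine (ih (b + 2) _).mono ?_
      rintro m - - - rm' ⟨h1, h2, h3⟩
      refine ⟨fun a ha => ?_, ?_, by omega⟩
      · rw [h1 a (by omega), Function.update_of_ne (by omega), Function.update_of_ne (by omega)]
      · rw [pairs_succ, h2, h1 b (by omega), h1 (b + 1) (by omega), pairs_succ,
          List.orderedInsert_of_not_le _ _ (by simpa using h)]
        simp [Function.update_of_ne]
        congr 1
        refine pairs_congr fun a ha _ => ?_
        rw [Function.update_of_ne (by omega), Function.update_of_ne (by omega)]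
    · refine ⟨fun a ha => ?_, ?_, by omega⟩
      · rw [Function.update_of_ne (by omega), Function.update_of_ne (by omega)]
      · rw [pairs_succ rm, List.orderedInsert_cons_of_le _ _ (by simpa using h), ← pairs_succ,
          pairs_succ]
        congr 1
        · simp
        · refine pairs_congr fun a ha _ => ?_
          rw [Function.update_of_ne (by omega), Function.update_of_ne (by omega)]

open scoped Classical in
-- Quadratic time is affordable, since the bound contains `n² log (k + 1)` and `k ≥ 1`.
theorem call_sort (h10 : procs[10]? = some sinkBody) (h11 : procs[11]? = some sortBody)
    (nm : ℕ → ℕ) (len b : ℕ) (rm : ℕ → ℝ) :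
    Call procs 11 [b, len] [] nm rm (fun m _ _ _ rm' => (∀ a < b, rm' a = rm a) ∧
      pairs rm' b len = (pairs rm b len).insertionSort (fun x y => x.1 ≤ y.1) ∧
      m ≤ 100 * (len + 1) ^ 2) := by
  induction len generalizing b rm with
  | zero =>
    refine Call.intro h11 ?_
    simp [sortBody]
  | succ len ih =>
    refine Call.intro h11 ?_
    simp [sortBody]
    refine (ih (b + 2) rm).mono ?_
    rintro m - - nm1 rm1 ⟨h1, h2, h3⟩
    refine (call_sink h10 _ _ nm1 len b rm1).mono ?_
    rintro m2 - - nm2 rm2 ⟨h4, h5, h6⟩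
    refine ⟨fun a ha => ?_, ?_, ?_⟩
    · rw [h4 a ha, h1 a (by omega)]
    · rw [h5, h2, pairs_succ, List.insertionSort_cons, h1 b (by omega), h1 (b + 1) (by omega)]
    · have : 100 * (len + 1 + 1) ^ 2 = 100 * (len + 1) ^ 2 + 200 * len + 300 := by ring
      omega

/-- The coordinate along a line, given by a point and a direction, and the squared distance from the
line. -/
def project (px py ux uy : ℝ) (p : ℝ × ℝ) : ℝ × ℝ :=
  let a := (p.1 - px) * ux + (p.2 - py) * uy
  (a, (p.1 - px) ^ 2 + (p.2 - py) ^ 2 - a ^ 2)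

/-- Procedure 12: replaces points of the plane by their coordinates along a line and their squared
distances from it. -/
def projectBody : Cmd :=
  .cond (.ltN 0 (N 1))
    (.setR 4 (RM (N 0) - R 0) ++ .setR 5 (RM (N 0 + 1) - R 1) ++
      .setR 6 (R 4 * R 2 + R 5 * R 3) ++ .storeR (N 0) (R 6) ++
      .storeR (N 0 + 1) (R 4 * R 4 + R 5 * R 5 - R 6 * R 6) ++
      .call 2 8 12 [N 0 + 2, N 1 - 1] [R 0, R 1, R 2, R 3])
    .skip

theorem call_project (h12 : procs[12]? = some projectBody) (px py ux uy : ℝ) (nm : ℕ → ℕ)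
    (len b : ℕ) (rm : ℕ → ℝ) :
    Call procs 12 [b, len] [px, py, ux, uy] nm rm (fun m _ _ _ rm' => (∀ a < b, rm' a = rm a) ∧
      pairs rm' b len = (pairs rm b len).map (project px py ux uy) ∧ m ≤ 100 * (len + 1)) := by
  induction len generalizing b rm with
  | zero =>
    refine Call.intro h12 ?_
    simp [projectBody]
  | succ len ih =>
    refine Call.intro h12 ?_
    simp [projectBody]
    refine (ih (b + 2) _).mono ?_
    rintro m - - nm1 rm1 ⟨h1, h2, h3⟩
    refine ⟨fun a ha => ?_, ?_, by omega⟩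
    · rw [h1 a (by omega), Function.update_of_ne (by omega), Function.update_of_ne (by omega)]
    · rw [pairs_succ, pairs_succ, h2, h1 b (by omega), h1 (b + 1) (by omega), List.map_cons]
      congr 1
      · simp [project, sq]
      · congr 1
        refine pairs_congr fun a ha _ => ?_
        rw [Function.update_of_ne (by omega), Function.update_of_ne (by omega)]

/-- Procedure 13: writes one row for each second point. -/
def rowInitBody : Cmd :=
  .cond (.ltN 0 (N 2))
    (.storeN (N 0) (N 1) ++ .storeN (N 0 + 1) (N 2 - 1 + (N 2 - 1)) ++ .storeN (N 0 + 2) 0 ++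
      .storeN (N 0 + 3) (N 3) ++ .call 0 2 13 [N 0 + 4, N 1, N 2 - 1, N 3] [])
    .skip

/-- Procedure 14: writes the rows for all pairs of points. -/
def gridBody : Cmd :=
  .cond (.ltN 0 (N 1))
    (.call 4 2 13 [N 0, N 1 - 1 + (N 1 - 1), N 2, N 3] [] ++
      .call 0 2 14 [N 4, N 1 - 1, N 2, N 3] [])
    .skip

theorem call_rowInit (h13 : procs[13]? = some rowInitBody) (i k : ℕ) (rm : ℕ → ℝ) (len b : ℕ)
    (nm : ℕ → ℕ) :
    Call procs 13 [b, i, len, k] [] nm rm (fun m n _ nm' rm' => rm' = rm ∧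
      (∀ a < b, nm' a = nm a) ∧ n = b + 4 * len ∧
      (∀ r, r ∈ rows nm' b len ↔ ∃ j < len, r = (i, 2 * j, 0, k)) ∧ m ≤ 50 * (len + 1)) := by
  induction len generalizing b nm with
  | zero =>
    refine Call.intro h13 ?_
    simp [rowInitBody]
  | succ len ih =>
    refine Call.intro h13 ?_
    simp [rowInitBody]
    refine (ih (b + 4) _).mono ?_
    rintro m n - nm1 rm1 ⟨rfl, h1, rfl, h2, h3⟩
    refine ⟨rfl, fun a ha => ?_, by omega, fun a1 a2 a3 a4 => ?_, by omega⟩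
    · rw [h1 a (by omega)]
      repeat rw [Function.update_of_ne (by omega)]
    · rw [rows_succ, List.mem_cons, h2, h1 b (by omega), h1 (b + 1) (by omega),
        h1 (b + 2) (by omega), h1 (b + 3) (by omega)]
      simp
      constructor
      · rintro (⟨rfl, rfl, rfl, rfl⟩ | ⟨j, hj, rfl, rfl, rfl, rfl⟩)
        exacts [⟨len, by omega, by omega⟩, ⟨j, by omega, rfl, rfl, rfl, rfl⟩]
      · rintro ⟨j, hj, rfl, rfl, rfl, rfl⟩
        rcases hj.lt_or_eq with hj | rfl
        exacts [.inr ⟨j, hj, rfl, rfl, rfl, rfl⟩, .inl ⟨rfl, by omega, rfl, rfl⟩]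

theorem call_grid (h13 : procs[13]? = some rowInitBody) (h14 : procs[14]? = some gridBody)
    (w k : ℕ) (rm : ℕ → ℝ) (len b : ℕ) (nm : ℕ → ℕ) :
    Call procs 14 [b, len, w, k] [] nm rm (fun m n _ nm' rm' => rm' = rm ∧
      (∀ a < b, nm' a = nm a) ∧ n = b + 4 * (len * w) ∧
      (∀ r, r ∈ rows nm' b (len * w) ↔ ∃ i < len, ∃ j < w, r = (2 * i, 2 * j, 0, k)) ∧
      m ≤ 100 * ((len + 1) * (w + 1))) := by
  induction len generalizing b nm with
  | zero =>
    refine Call.intro h14 ?_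
    simp [gridBody]
    omega
  | succ len ih =>
    refine Call.intro h14 ?_
    simp [gridBody]
    refine (call_rowInit h13 _ k rm w b nm).mono ?_
    rintro m n - nm1 rm1 ⟨rfl, h1, rfl, h2, h3⟩
    refine (ih (b + 4 * w) nm1).mono ?_
    rintro m n - nm2 rm2 ⟨rfl, h4, rfl, h5, h6⟩
    refine ⟨rfl, fun a ha => ?_, by ring, fun a1 a2 a3 a4 => ?_, ?_⟩
    · rw [h4 a (by omega), h1 a ha]
    · rw [show (len + 1) * w = w + len * w by ring, rows_add, List.mem_append, h5,
        rows_congr (nm := nm1) (fun a _ h => h4 a h), h2]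
      constructor
      · rintro (⟨j, hj, e⟩ | ⟨i, hi, j, hj, e⟩)
        exacts [⟨len, by omega, j, hj, by simpa [two_mul] using e⟩, ⟨i, by omega, j, hj, by simpa using e⟩]
      · rintro ⟨i, hi, j, hj, e⟩
        rcases hi.lt_or_eq with hi | rfl
        exacts [.inr ⟨i, hi, j, hj, by simpa using e⟩, .inl ⟨j, hj, by simpa [two_mul] using e⟩]
    · have : (len + 1 + 1) * (w + 1) = (len + 1) * (w + 1) + (w + 1) := by ring
      omega

/-! ### The number of steps -/

theorem searchCost_mono {R₀ E N N' : ℝ} (hR₀ : 0 < R₀) (hE : 0 ≤ E) (hN : 0 ≤ N) (h : N ≤ N') :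
    searchCost R₀ E N ≤ searchCost R₀ E N' := by
  unfold searchCost
  gcongr

theorem one_le_two_mul_log {k : ℕ} (hk : 1 ≤ k) : 1 ≤ 2 * Real.log ((k : ℝ) + 1) := by
  have h1 : Real.log 2 ≤ Real.log ((k : ℝ) + 1) := by
    apply Real.log_le_log (by norm_num)
    have : (1 : ℝ) ≤ k := by exact_mod_cast hk
    linarith
  have := Real.log_two_gt_d9
  linarith

theorem log_two_le_two_mul_log {k : ℕ} (hk : 1 ≤ k) :
    (Nat.log 2 k : ℝ) ≤ 2 * Real.log ((k : ℝ) + 1) := by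
  have h1 : ((2 ^ Nat.log 2 k : ℕ) : ℝ) ≤ k := by
    exact_mod_cast Nat.pow_log_le_self 2 (by omega)
  have h2 := Real.log_le_log (by positivity) (h1.trans (by linarith : (k : ℝ) ≤ k + 1))
  push_cast at h2
  rw [Real.log_pow] at h2
  have h3 := Real.log_two_gt_d9
  have : (0 : ℝ) ≤ Nat.log 2 k := by positivity
  nlinarith

theorem total_cost_le {n k : ℕ} (hn : 1 ≤ n) (hk : 1 ≤ k) {m W : ℝ} (hW : 0 ≤ W)
    (hWk : W ≤ ((n : ℝ) + 2) ^ 2 * k)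
    (hm : m ≤ 1000 * ((n : ℝ) + 2) ^ 2 + searchCost (((n : ℝ) + 2) ^ 2)
      (((Nat.log 2 k + 1 + 1) * (n + 1) : ℕ) : ℝ) W) :
    m ≤ (72 * roundCost + 1000000) * ((n : ℝ) ^ 2 * Real.log ((k : ℝ) + 1) +
      (n : ℝ) * Real.log ((k : ℝ) + 1) * Real.log ((n : ℝ) ^ 2 + (k : ℝ))) := by
  have hn' : (1 : ℝ) ≤ n := by exact_mod_cast hn
  have hk' : (1 : ℝ) ≤ k := by exact_mod_cast hk
  have hR : ((n : ℝ) + 2) ^ 2 ≤ 9 * (n : ℝ) ^ 2 := by nlinarith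
  have hR0 : 0 < ((n : ℝ) + 2) ^ 2 := by positivity
  have hlog := one_le_two_mul_log hk
  have hlog2 := log_two_le_two_mul_log hk
  set l := Real.log ((k : ℝ) + 1) with hl
  set M := Real.log ((n : ℝ) ^ 2 + (k : ℝ)) with hM
  have hE : (((Nat.log 2 k + 1 + 1) * (n + 1) : ℕ) : ℝ) ≤ 12 * (n * l) := by
    push_cast
    have : (Nat.log 2 k : ℝ) + 1 + 1 ≤ 6 * l := by linarith
    calc ((Nat.log 2 k : ℝ) + 1 + 1) * ((n : ℝ) + 1) ≤ (6 * l) * (2 * n) := by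
          gcongr
          all_goals linarith
      _ = _ := by ring
  have h1 := searchCost_mono (E := (((Nat.log 2 k + 1 + 1) * (n + 1) : ℕ) : ℝ)) hR0
    (Nat.cast_nonneg _) hW hWk
  -- With `y = n²`, the argument is at most `16 y k`, and both `4` and `4 y k` are at most `(y +
  -- k)²`.
  have h2 : Real.log (1 + ((n : ℝ) + 2) ^ 2 * k) ≤ 4 * M := by
    have e : (4 : ℝ) * M = Real.log (((n : ℝ) ^ 2 + (k : ℝ)) ^ 4) := by
      rw [Real.log_pow, hM]; norm_num
    rw [e]
    apply Real.log_le_log (by positivity)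
    have a1 : (1 : ℝ) ≤ (n : ℝ) ^ 2 := by nlinarith
    set y := (n : ℝ) ^ 2
    have a2 : ((n : ℝ) + 2) ^ 2 * k ≤ 9 * y * k := by gcongr
    have a3 : (4 : ℝ) ≤ (y + k) ^ 2 := by nlinarith
    have a4 : 1 ≤ y * k := by nlinarith
    have a5 : 4 * (y * k) ≤ (y + k) ^ 2 := by nlinarith [sq_nonneg (y - k)]
    calc 1 + ((n : ℝ) + 2) ^ 2 * k ≤ 4 * (4 * (y * k)) := by nlinarith
      _ ≤ (y + k) ^ 2 * (y + k) ^ 2 := by gcongr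
      _ = _ := by ring
  have hM0 : 0 ≤ Real.log (1 + ((n : ℝ) + 2) ^ 2 * k) := Real.log_nonneg (by
    have : 0 ≤ ((n : ℝ) + 2) ^ 2 * k := by positivity
    linarith)
  have hl0 : 0 ≤ l := by linarith
  unfold searchCost at h1 hm
  rw [mul_div_cancel_left₀ _ hR0.ne', add_comm 1 (k : ℝ), ← hl] at h1
  have h3 : (((Nat.log 2 k + 1 + 1) * (n + 1) : ℕ) : ℝ) *
      (8 * Real.log (1 + ((n : ℝ) + 2) ^ 2 * k)) ≤ 12 * (n * l) * (8 * (4 * M)) := by gcongr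
  have h4 : (roundCost : ℝ) * (8 * (((n : ℝ) + 2) ^ 2 * l)) ≤
      roundCost * (8 * (9 * (n : ℝ) ^ 2 * l)) := by gcongr
  have h5 : 1000 * ((n : ℝ) + 2) ^ 2 + 10 ≤ 18020 * ((n : ℝ) ^ 2 * l) := by
    have e1 : (n : ℝ) ^ 2 * 1 ≤ (n : ℝ) ^ 2 * (2 * l) := by gcongr
    nlinarith
  have h6 : 0 ≤ (n : ℝ) ^ 2 * l := by positivity
  have h7 : 0 ≤ n * l * M := by
    have : 0 ≤ M := by linarith
    positivity
  have h8 : 0 ≤ (roundCost : ℝ) * (n * l * M) := by positivity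
  nlinarith

/-! ### The planar problem on the line -/

theorem free_iff {v x : ℝ} {p : ℝ × ℝ} : Free v p x ↔ v ^ 2 ≤ (x - p.1) ^ 2 + p.2 := by
  have h : rad v p ≤ |x - p.1| ↔ v ^ 2 ≤ (x - p.1) ^ 2 + p.2 := by
    unfold rad
    rw [Real.sqrt_le_left (abs_nonneg _), sq_abs, sub_le_iff_le_add]
  rw [← h, le_abs, Free]
  constructor
  · rintro (h | h)
    exacts [.inr (by linarith), .inl (by linarith)]
  · rintro (h | h)
    exacts [.inr (by linarith), .inl (by linarith)]

theorem dist_sq (x y : EuclideanSpace ℝ (Fin 2)) :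
    dist x y ^ 2 = (x 0 - y 0) ^ 2 + (x 1 - y 1) ^ 2 := by
  rw [EuclideanSpace.dist_eq, Real.sq_sqrt (by positivity), Fin.sum_univ_two]
  simp [Real.dist_eq, sq_abs]

/-- Coordinates of a point of the plane relative to the line through `p` and `q`. -/
noncomputable def lineCoord (p q x : EuclideanSpace ℝ (Fin 2)) : ℝ × ℝ :=
  project (p 0) (p 1) ((q 0 - p 0) / dist p q) ((q 1 - p 1) / dist p q) (x 0, x 1)

theorem lineMap_apply_coord (p q : EuclideanSpace ℝ (Fin 2)) (s : ℝ) (i : Fin 2) :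
    (AffineMap.lineMap p q s : EuclideanSpace ℝ (Fin 2)) i = p i + s * (q i - p i) := by
  simp [AffineMap.lineMap_apply]
  ring

/-- Pythagoras. If `p = q`, division by zero makes the direction `0`; every coordinate is then `0`
and `w` is the squared distance from `p`, so the formula persists. -/
theorem dist_lineMap_sq (p q x : EuclideanSpace ℝ (Fin 2)) (s : ℝ) :
    dist x (AffineMap.lineMap p q s) ^ 2 =
      (s * dist p q - (lineCoord p q x).1) ^ 2 + (lineCoord p q x).2 := by
  have hL := dist_sq p q
  rw [dist_sq, lineMap_apply_coord, lineMap_apply_coord]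
  simp only [lineCoord, project]
  rcases eq_or_ne (dist p q) 0 with h | h
  · obtain rfl := dist_eq_zero.1 h
    simp
  · field_simp
    linear_combination -(s ^ 2 * dist p q ^ 2) * hL

theorem lineCoord_nonneg (p q x : EuclideanSpace ℝ (Fin 2)) : 0 ≤ (lineCoord p q x).2 := by
  have hL := dist_sq p q
  simp only [lineCoord, project]
  rcases eq_or_ne (dist p q) 0 with h | h
  · simp [h]; positivity
  · have e : (x 0 - p 0) ^ 2 + (x 1 - p 1) ^ 2 - ((x 0 - p 0) * ((q 0 - p 0) / dist p q) +
        (x 1 - p 1) * ((q 1 - p 1) / dist p q)) ^ 2 =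
        (((x 0 - p 0) * (q 1 - p 1) - (x 1 - p 1) * (q 0 - p 0)) / dist p q) ^ 2 := by
      field_simp
      linear_combination ((x 0 - p 0) ^ 2 + (x 1 - p 1) ^ 2) * hL
    rw [e]
    positivity

theorem feas_iff_exists_placement {n k : ℕ} {P : Fin n → EuclideanSpace ℝ (Fin 2)}
    {p q : EuclideanSpace ℝ (Fin 2)} {α v : ℝ} (hα : 0 < α) (hv : 0 ≤ v) {pts : List (ℝ × ℝ)}
    (hpts : ∀ x, x ∈ pts ↔ ∃ i, lineCoord p q (P i) = x) :
    Feas pts (dist p q) α k v ↔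
      ∃ c : Fin k → EuclideanSpace ℝ (Fin 2), IsPlacement p q c ∧ ∀ t ∈ coflTerms P α c, v ≤ t := by
  have hfree : ∀ (i : Fin n) (s : ℝ), Free v (lineCoord p q (P i)) (s * dist p q) ↔
      v ≤ dist (P i) (AffineMap.lineMap p q s) := fun i s => by
    rw [free_iff, ← dist_lineMap_sq, sq_le_sq₀ hv dist_nonneg]
  constructor
  · rintro ⟨x, h1, h2⟩
    -- For a degenerate segment all positions are `0`, which matches the value `0` of the quotient.
    have hs : ∀ j < k, x j / dist p q * dist p q = x j := fun j hj => by
      rcases eq_or_ne (dist p q) 0 with h | h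
      · have h3 := (h1 j hj).1
        have h4 := (h1 j hj).2.1
        rw [h] at h4
        simp [h, le_antisymm h4 h3]
      · exact div_mul_cancel₀ _ h
    have hmono : ∀ i j, i ≤ j → j < k → x i ≤ x j := by
      intro i j hij
      induction j, hij using Nat.le_induction with
      | base => exact fun _ => le_rfl
      | succ j hij ih =>
        intro hj
        have e := (mul_nonneg_iff_of_pos_left hα).1 (hv.trans (h2 j hj))
        linarith [ih (by omega)]
    refine ⟨fun j => AffineMap.lineMap p q (x j / dist p q), ⟨fun j => x j / dist p q, fun i j hij =>
      div_le_div_of_nonneg_right (hmono i j hij j.2) dist_nonneg, fun j => ⟨⟨?_, ?_⟩, rfl⟩⟩, ?_⟩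
    · exact div_nonneg (h1 j j.2).1 dist_nonneg
    · exact div_le_one_of_le₀ (h1 j j.2).2.1 dist_nonneg
    · rintro t (⟨i, j, rfl⟩ | ⟨i, j, hij, rfl⟩)
      · rw [← hfree, hs j j.2]
        exact (h1 j j.2).2.2 _ ((hpts _).2 ⟨i, rfl⟩)
      · have := h2 i (by omega)
        rw [hij] at this
        rw [dist_lineMap_lineMap, Real.dist_eq, ← abs_of_nonneg (dist_nonneg (x := p) (y := q)),
          ← abs_mul, sub_mul, abs_of_nonneg (dist_nonneg (x := p) (y := q)), hs i i.2, hs j j.2]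
        refine this.trans ?_
        rw [abs_sub_comm]
        gcongr
        exact le_abs_self _
  · rintro ⟨c, ⟨s, hs, hc⟩, ht⟩
    refine ⟨fun j => if h : j < k then s ⟨j, h⟩ * dist p q else 0, fun j hj => ?_, fun j hj => ?_⟩
    · simp only [dif_pos hj]
      obtain ⟨⟨a1, a2⟩, a3⟩ := hc ⟨j, hj⟩
      refine ⟨by positivity, mul_le_of_le_one_left dist_nonneg a2, fun x hx => ?_⟩
      obtain ⟨i, rfl⟩ := (hpts x).1 hx
      rw [hfree, ← a3]
      exact ht _ (.inl ⟨i, _, rfl⟩)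
    · simp only [dif_pos hj, dif_pos (show j < k by omega)]
      have h1 := ht _ (.inr ⟨⟨j, by omega⟩, ⟨j + 1, hj⟩, rfl, rfl⟩)
      have h2 := hs (show (⟨j, by omega⟩ : Fin k) ≤ ⟨j + 1, hj⟩ from Nat.le_succ j)
      rw [(hc _).2, (hc _).2, dist_lineMap_lineMap, dist_comm, Real.dist_eq,
        abs_of_nonneg (by linarith), sub_mul] at h1
      exact h1

theorem finite_coflTerms {n k : ℕ} (P : Fin n → EuclideanSpace ℝ (Fin 2)) (α : ℝ)
    (c : Fin k → EuclideanSpace ℝ (Fin 2)) : (coflTerms P α c).Finite := by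
  refine Set.Finite.union ?_ ?_
  · refine (Set.finite_range (fun z : Fin n × Fin k => dist (P z.1) (c z.2))).subset ?_
    rintro _ ⟨i, j, rfl⟩
    exact ⟨(i, j), rfl⟩
  · refine (Set.finite_range (fun z : Fin k × Fin k => α * dist (c z.1) (c z.2))).subset ?_
    rintro _ ⟨i, j, -, rfl⟩
    exact ⟨(i, j), rfl⟩

/-- `Feas` only says that all terms are at least `r`. Their minimum exists, as there are finitely
many and at least one, and it cannot exceed `r`; so it equals `r`. -/
theorem IsOptimum.isOptimalRadius {n k : ℕ} (hn : 1 ≤ n) (hk : 1 ≤ k)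
    {P : Fin n → EuclideanSpace ℝ (Fin 2)} {p q : EuclideanSpace ℝ (Fin 2)} {α r : ℝ} (hα : 0 < α)
    {pts : List (ℝ × ℝ)} (hpts : ∀ x, x ∈ pts ↔ ∃ i, lineCoord p q (P i) = x)
    (h : IsOptimum pts (dist p q) α k r) : IsOptimalRadius k P p q α r := by
  obtain ⟨h0, h1, h2⟩ := h
  have hle : ∀ l, ∀ c : Fin k → EuclideanSpace ℝ (Fin 2), IsPlacement p q c → IsLeast (coflTerms P α c) l → l ≤ r := by
    intro l c hc hl
    by_contra! hlt
    exact h2 l hlt ((feas_iff_exists_placement hα (h0.trans hlt.le) hpts).2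
      ⟨c, hc, fun t ht => hl.2 ht⟩)
  refine ⟨?_, fun l ⟨c, hc, hl⟩ => hle l c hc hl⟩
  obtain ⟨c, hc, ht⟩ := (feas_iff_exists_placement hα h0 hpts).1 h1
  obtain ⟨l, hl, hmin⟩ := Set.exists_min_image _ id (finite_coflTerms P α c)
    ⟨_, .inl ⟨⟨0, hn⟩, ⟨0, hk⟩, rfl⟩⟩
  have hlr := le_antisymm (hle l c hc ⟨hl, hmin⟩) (ht l hl)
  exact ⟨c, hc, hlr ▸ ⟨hl, hmin⟩⟩

/-! ### The program -/

/-- The main command. -/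
def mainCmd : Cmd :=
  .setR 5 ((R 2 - R 0) * (R 2 - R 0) + (R 3 - R 1) * (R 3 - R 1)).sqrt ++
    (.call 3 8 12 [0, N 0] [R 0, R 1, (R 2 - R 0) / R 5, (R 3 - R 1) / R 5] ++
    (.setR 6 (R 5 + (RM 0 * RM 0 + RM 1).sqrt + 1) ++
    (.call 3 8 11 [0, N 0] [] ++
    (.storeR (N 0 + N 0) 0 ++ .storeR (N 0 + N 0 + 1) (R 6 * R 6) ++
      .storeR (N 0 + N 0 + 2) (R 5) ++ .storeR (N 0 + N 0 + 3) (R 6 * R 6) ++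
    (.call 2 8 14 [0, N 0 + 2, N 0 + 2, N 1] [] ++
      .call 3 0 9 [(N 2).half.half, N 2, N 0, N 1] [0, R 6, R 4, R 5])))))

/-- The program for the problem on a segment. -/
def coflProgram : Program where
  procs := [weighBody, filtBody, med9Body, selBody, bsearchBody, decBody, candBody, rowvalsBody,
    pruneBody, searchBody, sinkBody, sortBody, projectBody, rowInitBody, gridBody]
  main := mainCmd

theorem feas_zero {pts : List (ℝ × ℝ)} {L α : ℝ} {k : ℕ} (hL : 0 ≤ L) (h : ∀ x ∈ pts, 0 ≤ x.2) :
    Feas pts L α k 0 := by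
  refine ⟨fun _ => 0, fun j _ => ⟨le_rfl, hL, fun x hx => ?_⟩, fun j _ => by simp⟩
  rw [free_iff]
  nlinarith [h x hx, sq_nonneg (0 - x.1)]

/-- By the triangle inequality through the end `0`, no position in `[0, L]` is further than `L +
√(x.1² + x.2)` from the point. This gives the initial infeasible radius. -/
theorem not_feas_of_far {pts : List (ℝ × ℝ)} {L α : ℝ} {k : ℕ} (hk : 1 ≤ k) {x : ℝ × ℝ}
    (hx : x ∈ pts) (hw : 0 ≤ x.2) (hL : 0 ≤ L) :
    ¬ Feas pts L α k (L + √(x.1 * x.1 + x.2) + 1) := by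
  rintro ⟨z, h, -⟩
  obtain ⟨h1, h2, h3⟩ := h 0 hk
  have h4 := free_iff.1 (h3 x hx)
  have h5 : 0 ≤ x.1 * x.1 + x.2 := add_nonneg (mul_self_nonneg _) hw
  have h6 := Real.sq_sqrt h5
  have h7 := Real.sqrt_nonneg (x.1 * x.1 + x.2)
  set S := √(x.1 * x.1 + x.2)
  have h8 : |x.1| ≤ S := Real.le_sqrt_of_sq_le (by rw [sq_abs]; nlinarith)
  have h9 := neg_le_of_abs_le h8
  nlinarith [mul_le_mul_of_nonneg_left h9 h1, mul_le_mul_of_nonneg_right h2 h7]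

theorem rowSum_le {l : List (ℕ × ℕ × ℕ × ℕ)} {k : ℕ} (h : ∀ r ∈ l, r.2.2.2 ≤ k) :
    rowSum l ≤ l.length * k := by
  induction l with
  | nil => simp
  | cons r l ih =>
    have h1 := ih (fun r hr => h r (List.mem_cons_of_mem _ hr))
    have h2 := h r List.mem_cons_self
    rw [rowSum_cons, List.length_cons, Nat.succ_mul]
    omega

theorem mem_pairs_input {n k : ℕ} (P : Fin n → EuclideanSpace ℝ (Fin 2))
    (p q : EuclideanSpace ℝ (Fin 2)) (α : ℝ) (x : ℝ × ℝ) :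
    x ∈ pairs (coflInput k P p q α).rmem 0 n ↔ ∃ i, (P i 0, P i 1) = x := by
  have e : ∀ i (hi : i < n), ((coflInput k P p q α).rmem (0 + 2 * i),
      (coflInput k P p q α).rmem (0 + 2 * i + 1)) = (P ⟨i, hi⟩ 0, P ⟨i, hi⟩ 1) := by
    intro i hi
    have e1 : (2 * i + 1) / 2 = i := by omega
    have e2 : (2 * i + 1) % 2 = 1 := by omega
    simp [coflInput, hi, e1, e2]
  rw [mem_pairs]
  constructor
  · rintro ⟨i, hi, rfl⟩
    exact ⟨⟨i, hi⟩, (e i hi).symm⟩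
  · rintro ⟨i, rfl⟩
    exact ⟨i, i.2, (e i i.2).symm⟩

theorem dist_eq_sqrt (p q : EuclideanSpace ℝ (Fin 2)) :
    √((q 0 - p 0) * (q 0 - p 0) + (q 1 - p 1) * (q 1 - p 1)) = dist p q := by
  rw [dist_comm, ← sq, ← sq, ← dist_sq, Real.sqrt_sq dist_nonneg]

/-- The memory after the two ends of the segment have been stored behind the points. -/
theorem instance_of_pairs {n k : ℕ} {α L H : ℝ} (hα : 0 < α) {rm : ℕ → ℝ} {pts : List (ℝ × ℝ)}
    (hpts : pairs rm 0 n = pts) (hsort : pts.Pairwise (fun x y => x.1 ≤ y.1))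
    (hnn : ∀ x ∈ pts, 0 ≤ x.2) (h0 : rm (n + n) = 0) (h1 : rm (n + n + 1) = H * H)
    (h2 : rm (n + n + 2) = L) (h3 : rm (n + n + 3) = H * H) :
    Instance rm n k (Nat.log 2 k + 1) (4 * ((n + 2) * (n + 2))) α L H where
  pos := hα
  sorted := hpts ▸ hsort
  ends := by
    rw [pairs_add, pairs_succ, pairs_succ, pairs_zero, zero_add, two_mul, h0, h1, sq]
    rw [add_assoc (n + n) 2 1, h2, h3]
  nonneg i hi := by
    rcases lt_or_ge i n with h | h
    · have := hnn _ (hpts ▸ mem_pairs.2 ⟨i, h, rfl⟩)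
      simpa using this
    · rcases (show i = n ∨ i = n + 1 by omega) with rfl | rfl
      · rw [two_mul, h1]; exact mul_self_nonneg _
      · rw [show 2 * (n + 1) + 1 = n + n + 3 by ring, h3]; exact mul_self_nonneg _
  le := by nlinarith
  lt := Nat.lt_pow_succ_log_self (by norm_num) k

theorem wp_mainCmd {n k : ℕ} (hn : 1 ≤ n) (hk : 1 ≤ k) (P : Fin n → EuclideanSpace ℝ (Fin 2))
    (p q : EuclideanSpace ℝ (Fin 2)) {α : ℝ} (hα : 0 < α) :
    Wp coflProgram.procs mainCmd (coflInput k P p q α) (fun m t =>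
      IsOptimalRadius k P p q α (t.rvar 0) ∧ ∃ W : ℕ, W ≤ (n + 2) * (n + 2) * k ∧
      (m : ℝ) ≤ 1000 * ((n : ℝ) + 2) ^ 2 + searchCost (((n : ℝ) + 2) ^ 2)
        (((Nat.log 2 k + 1 + 1) * (n + 1) : ℕ) : ℝ) W) := by
  have hin := mem_pairs_input (k := k) P p q α
  generalize hrm : (coflInput k P p q α).rmem = rm at hin
  have hs : coflInput k P p q α =
    ⟨env [n, k], env [p 0, p 1, q 0, q 1, α], fun _ => 0, rm⟩ := by rw [← hrm]; rfl
  rw [hs]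
  simp [mainCmd, dist_eq_sqrt]
  refine (call_project rfl _ _ _ _ _ n 0 rm).mono ?_
  rintro m1 - - nm1 rm1 ⟨-, h1, hm1⟩
  refine (call_sort rfl rfl _ n 0 rm1).mono ?_
  rintro m2 - - nm2 rm2 ⟨-, h2, hm2⟩
  have hmem1 : ∀ x, x ∈ pairs rm1 0 n ↔ ∃ i, lineCoord p q (P i) = x := fun x => by
    rw [h1, List.mem_map]
    constructor
    · rintro ⟨y, hy, rfl⟩
      obtain ⟨i, rfl⟩ := (hin y).1 hy
      exact ⟨i, rfl⟩
    · rintro ⟨i, rfl⟩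
      exact ⟨_, (hin _).2 ⟨i, rfl⟩, rfl⟩
  have hpts : ∀ x, x ∈ pairs rm2 0 n ↔ ∃ i, lineCoord p q (P i) = x := fun x => by
    rw [h2, List.mem_insertionSort, hmem1]
  have hsort : (pairs rm2 0 n).Pairwise (fun x y => x.1 ≤ y.1) := by
    have : Std.Total (fun x y : ℝ × ℝ => x.1 ≤ y.1) := ⟨fun x y => le_total x.1 y.1⟩
    have : IsTrans (ℝ × ℝ) (fun x y : ℝ × ℝ => x.1 ≤ y.1) := ⟨fun x y z => le_trans⟩
    rw [h2]
    exact List.pairwise_insertionSort _ _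
  have hnn : ∀ x ∈ pairs rm2 0 n, 0 ≤ x.2 := fun x hx => by
    obtain ⟨i, rfl⟩ := (hpts x).1 hx
    exact lineCoord_nonneg p q _
  -- `H` is computed from the first point before sorting; sorting keeps that point in the list.
  have hfirst : (rm1 0, rm1 1) ∈ pairs rm2 0 n :=
    (hpts _).2 ((hmem1 _).1 (mem_pairs.2 ⟨0, hn, rfl⟩))
  have hfar := not_feas_of_far (α := α) hk hfirst (hnn _ hfirst) (dist_nonneg (x := p) (y := q))
  simp only at hfar
  have hH : 0 < dist p q + √(rm1 0 * rm1 0 + rm1 1) + 1 := by positivity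
  set H := dist p q + √(rm1 0 * rm1 0 + rm1 1) + 1
  set rm3 := Function.update (Function.update (Function.update (Function.update rm2 (n + n) 0)
    (n + n + 1) (H * H)) (n + n + 2) (dist p q)) (n + n + 3) (H * H) with hrm3
  have hpts3 : pairs rm3 0 n = pairs rm2 0 n := pairs_congr fun a _ ha => by
    rw [hrm3]
    repeat rw [Function.update_of_ne (by omega)]
  have hI : Instance rm3 n k (Nat.log 2 k + 1) (4 * ((n + 2) * (n + 2))) α (dist p q) H :=
    instance_of_pairs hα hpts3 hsort hnn (by simp [hrm3]) (by simp [hrm3]) (by simp [hrm3])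
      (by simp [hrm3])
  refine (call_grid rfl rfl (n + 2) k rm3 (n + 2) 0 nm2).mono ?_
  rintro m3 B - nm3 rm4 ⟨rfl, -, rfl, h3, hm3⟩
  -- Natural numbers cannot be multiplied in unit time, so the number of rows is recovered from the
  -- first free address by halving twice.
  have hdiv : (0 + 4 * ((n + 2) * (n + 2))) / 2 / 2 = (n + 2) * (n + 2) := by omega
  rw [hdiv, zero_add]
  have hW : rowSum (rows nm3 0 ((n + 2) * (n + 2))) ≤ (n + 2) * (n + 2) * k := by
    have := rowSum_le (l := rows nm3 0 ((n + 2) * (n + 2))) (k := k) fun r hr => by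
      obtain ⟨i, -, j, -, rfl⟩ := (h3 r).1 hr
      exact le_rfl
    rwa [length_rows] at this
  have hbr : Bracket rm3 n k α (dist p q) H (rows nm3 0 ((n + 2) * (n + 2))) 0 H :=
    { row := fun r hr => by
        obtain ⟨i, hi, j, hj, rfl⟩ := (h3 r).1 hr
        exact ⟨⟨i, hi, rfl⟩, ⟨j, hj, rfl⟩, hk⟩
      nonneg := le_rfl
      lt := hH
      le := le_rfl
      feas := hpts3 ▸ feas_zero dist_nonneg hnn
      not_feas := hpts3 ▸ hfar
      mem := fun i hi j hj m hm c _ _ _ =>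
        ⟨_, (h3 _).2 ⟨i, hi, j, hj, rfl⟩, rfl, rfl, Nat.zero_le _, hm⟩ }
  refine (call_search (R₀ := ((n : ℝ) + 2) ^ 2) rfl rfl rfl rfl rfl rfl rfl rfl rfl rfl hI (by positivity) _
    ((n + 2) * (n + 2)) 0 H nm3 rm3 (fun _ _ => rfl) le_rfl (by push_cast; exact (sq _).ge) rfl
    hbr).mono ?_
  rintro m4 - r - - ⟨hr, hm4⟩
  rw [hpts3] at hr
  refine ⟨hr.isOptimalRadius hn hk hα hpts, _, hW, ?_⟩
  -- The numerals are the costs of the main command outside the called procedures.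
  have hm : 17 + (14 + m1 + 1 + (15 + (2 + m2 + 1 + (6 + 9 + 7 + 9 + (8 + m3 + 1 + (11 + 1)))))) ≤
      1000 * (n + 2) ^ 2 := by
    have e1 : (n + 1) ^ 2 = n * n + 2 * n + 1 := by ring
    have e2 : (n + 2 + 1) * (n + 2 + 1) = n * n + 6 * n + 9 := by ring
    have e3 : (n + 2) ^ 2 = n * n + 4 * n + 4 := by ring
    rw [e1] at hm2
    rw [e2] at hm3
    rw [e3]
    omega
  have hm' : ((17 + (14 + m1 + 1 + (15 + (2 + m2 + 1 + (6 + 9 + 7 + 9 + (8 + m3 + 1 + (11 + 1)))))) :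
      ℕ) : ℝ) ≤ 1000 * ((n : ℝ) + 2) ^ 2 := by exact_mod_cast hm
  push_cast at hm' hm4
  linarith

end RealRAM

theorem mainTheorem1 :
    ∃ (A : RealRAM.Program) (K : ℝ),
      ∀ (n k : ℕ), 1 ≤ n → 1 ≤ k →
        ∀ (P : Fin n → EuclideanSpace ℝ (Fin 2)) (p q : EuclideanSpace ℝ (Fin 2)) (α : ℝ), 0 < α →
          ∃ (T : ℕ) (t : RealRAM.State),
            A.HaltsIn (coflInput k P p q α) T t ∧
            IsOptimalRadius k P p q α (t.rvar 0) ∧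
            (T : ℝ) ≤ K * ((n : ℝ) ^ 2 * Real.log ((k : ℝ) + 1) +
              (n : ℝ) * Real.log ((k : ℝ) + 1) * Real.log ((n : ℝ) ^ 2 + (k : ℝ))) := by
  refine ⟨RealRAM.coflProgram, 72 * RealRAM.roundCost + 1000000, fun n k hn hk P p q α hα => ?_⟩
  obtain ⟨T, t, h1, h2, W, hW, h3⟩ := RealRAM.wp_mainCmd hn hk P p q hα
  refine ⟨T, t, h1, h2, RealRAM.total_cost_le hn hk (Nat.cast_nonneg W) ?_ h3⟩
  rw [sq]
  exact_mod_cast hW
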